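/- Let $\overline{\mathbb C}$ be the Riemann sphere and $\mathbb D$ the open unit disc. A marked hyperbolic disc $(D,z)$ consists of a simply connected domain $D\subset\overline{\mathbb C}$ whose complement has at least two points, and a point $z\in D$. An equipotential of $(D,z)$ is a set of the form $\gamma=\{x\in D : |\chi(x)|=r\}$ with $0<r<1$, where $\chi:D\to\mathbb D$ is a biholomorphic map with $\chi(z)=0$. Its potential is the modulus of the annulus between $\partial D$ and $\gamma$. Here the modulus of an annulus $A\subset\overline{\mathbb C}$ (a domain whose complement has exactly two connected components) is $\operatorname{mod}(A)=2\pi/\operatorname{cap}(A)$, where $\operatorname{cap}(A)$ is the infimum of $\int_A|\nabla u|^2$ over the continuous functions $u$ on $\overline{\mathbb C}$ that are $C^1$ on $A\setminus\{\infty\}$, equal to $0$ on one of the two complementary components and to $1$ on the other; it is normalized so that $\operatorname{mod}\{r<|z|<1\}=-\log r$. **Lemma (reversed Grötzsch inequality).** Let $(D_1,z_1)$ and $(D_2,z_2)$ be two marked hyperbolic discs in $\overline{\mathbb C}$ with $D_1\cap D_2=\emptyset$. Then there is a constant $C>0$, depending only on $(D_1,z_1)$ and $(D_2,z_2)$, such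 that for all $v_1>0$ and $v_2>0$ the annulus $A(v_1,v_2)$ between the equipotential of $(D_1,z_1)$ of potential $v_1$ and the equipotential of $(D_2,z_2)$ of potential $v_2$ satisfies $$v_1+v_2\le \operatorname{mod}(A(v_1,v_2))\le v_1+v_2+C .$$ -/

import Mathlib

open scoped ENNReal

noncomputable section

namespace MarkedDisc

/-- The Riemann sphere, with the topology of the one-point compactification of the plane. -/
abbrev Sphere : Type := OnePoint ℂ

/-- The standard holomorphic parametrization `w ↦ 1 / w` of the sphere around infinity. -/
def chartInfty (w : ℂ) : Sphere := if w = 0 then OnePoint.infty else ((w⁻¹ : ℂ) : Sphere)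

/-- A complex valued function on the sphere is holomorphic on the open set `D`: it is so in each of
the two standard coordinates `z` and `w = 1 / z`. -/
def HolomorphicOn (f : Sphere → ℂ) (D : Set Sphere) : Prop :=
  DifferentiableOn ℂ (fun z : ℂ => f z) {z : ℂ | (z : Sphere) ∈ D} ∧
    DifferentiableOn ℂ (fun w : ℂ => f (chartInfty w)) {w : ℂ | chartInfty w ∈ D}

/-- An open hyperbolic disc in the sphere: a simply connected domain whose complement has at least
two points. -/
structure IsHyperbolicDisc (D : Set Sphere) : Prop where
  isOpen : IsOpen D
  simplyConnected : IsSimplyConnected D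
  nontrivial_compl : Dᶜ.Nontrivial

/-- A conformal representation of the marked disc `(D, a)`: a biholomorphic map from `D` onto the
unit disc that sends `a` to `0`. -/
structure IsConformalRepresentation (D : Set Sphere) (a : Sphere) (χ : Sphere → ℂ) : Prop where
  holomorphicOn : HolomorphicOn χ D
  bijOn : Set.BijOn χ D (Metric.ball 0 1)
  map_mark : χ a = 0

/-- An equipotential of `(D, a)`: a curve in `D` that a conformal representation of `(D, a)` maps
onto a round circle centred at `0`. -/
def IsEquipotential (D : Set Sphere) (a : Sphere) (γ : Set Sphere) : Prop :=
  ∃ χ : Sphere → ℂ, IsConformalRepresentation D a χ ∧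
    ∃ r : ℝ, 0 < r ∧ r < 1 ∧ γ = {x ∈ D | ‖χ x‖ = r}

/-- The part of the sphere between two disjoint continua `K` and `L`: the union of the components
of the complement of `K ∪ L` that are adherent both to `K` and to `L`. -/
def annulusBetween (K L : Set Sphere) : Set Sphere :=
  {x | x ∈ (K ∪ L)ᶜ ∧
    (closure (connectedComponentIn (K ∪ L)ᶜ x) ∩ K).Nonempty ∧
    (closure (connectedComponentIn (K ∪ L)ᶜ x) ∩ L).Nonempty}

/-- `A` is an (open) annulus in the sphere, that is, a doubly connected domain: a connected open set
whose complement has exactly the two connected components `E` and `F`. -/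
structure IsAnnulus (A E F : Set Sphere) : Prop where
  isConnected : IsConnected A
  isClosed_left : IsClosed E
  isClosed_right : IsClosed F
  isConnected_left : IsConnected E
  isConnected_right : IsConnected F
  disjoint : Disjoint E F
  compl_eq : Aᶜ = E ∪ F

/-- The admissible functions for the capacity of the annulus `A`: continuously differentiable in
`A`, with boundary values `0` on one of the boundary components and `1` on the other one; they are
extended by these constants to the two complementary components. At the point at infinity, which
has zero capacity, continuity suffices. -/
def IsAdmissible (A : Set Sphere) (u : Sphere → ℝ) : Prop :=
  Continuous u ∧ ContDiffOn ℝ 1 (fun z : ℂ => u z) {z : ℂ | (z : Sphere) ∈ A} ∧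
    ∃ E F : Set Sphere, IsAnnulus A E F ∧ (∀ x ∈ E, u x = 0) ∧ (∀ x ∈ F, u x = 1)

/-- The conformal capacity of an annulus: the infimum of the Dirichlet integrals of the admissible
functions. -/
def capacity (A : Set Sphere) : ℝ≥0∞ :=
  ⨅ (u : Sphere → ℝ) (_ : IsAdmissible A u),
    ∫⁻ z in {z : ℂ | (z : Sphere) ∈ A}, ‖fderiv ℝ (fun w : ℂ => u w) z‖ₑ ^ 2

/-- The modulus of an annulus, normalized so that the round annulus `r < |z| < 1` has modulus
`-log r` (see `modulus_roundAnnulus`). It is `0`, by convention, if `A` is not an annulus. -/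
def modulus (A : Set Sphere) : ℝ≥0∞ := ENNReal.ofReal (2 * Real.pi) / capacity A

/-- The potential of an equipotential `γ` of a marked disc `(D, a)`: the modulus of the annulus
between the boundary of `D` and `γ`. -/
def potential (D γ : Set Sphere) : ℝ≥0∞ := modulus (annulusBetween (frontier D) γ)

section Normalization

theorem isConnected_norm_mem {I : Set ℝ} (hI : IsConnected I) (h0 : ∀ t ∈ I, 0 ≤ t) :
    IsConnected {z : ℂ | ‖z‖ ∈ I} := by
  have h : {z : ℂ | ‖z‖ ∈ I} =
      (fun p : ℝ × ℝ => (p.1 : ℂ) * Complex.exp (p.2 * Complex.I)) '' (I ×ˢ Set.univ) := by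
    ext z
    constructor
    · intro hz
      exact ⟨(‖z‖, z.arg), ⟨hz, trivial⟩, Complex.norm_mul_exp_arg_mul_I z⟩
    · rintro ⟨⟨t, θ⟩, ⟨ht, -⟩, rfl⟩
      have := h0 t ht
      simpa [Complex.norm_exp_ofReal_mul_I, abs_of_nonneg this] using ht
  rw [h]
  refine (hI.prod isConnected_univ).image _ (Continuous.continuousOn ?_)
  fun_prop

theorem lintegral_annulus {r : ℝ} (hr : 0 < r) {F : ℂ → ℝ≥0∞} (hF : Measurable F) :
    ∫⁻ z in {z : ℂ | r < ‖z‖ ∧ ‖z‖ < 1}, F z =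
      ∫⁻ θ in Set.Ioo (-Real.pi) Real.pi, ∫⁻ t in Set.Ioo r 1,
        ENNReal.ofReal t * F (t * Complex.exp (θ * Complex.I)) := by
  have hA : MeasurableSet {z : ℂ | r < ‖z‖ ∧ ‖z‖ < 1} :=
    ((isOpen_lt continuous_const continuous_norm).inter
      (isOpen_lt continuous_norm continuous_const)).measurableSet
  have hG : Measurable ({z : ℂ | r < ‖z‖ ∧ ‖z‖ < 1}.indicator F) := hF.indicator hA
  have hexp : Measurable fun p : ℝ × ℝ => (p.1 : ℂ) * Complex.exp (p.2 * Complex.I) :=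
    Continuous.measurable (by fun_prop)
  rw [← MeasureTheory.lintegral_indicator hA, ← Complex.lintegral_comp_polarCoord_symm]
  have hs : ∀ p : ℝ × ℝ, Complex.polarCoord.symm p = (p.1 : ℂ) * Complex.exp (p.2 * Complex.I) := by
    intro p
    rw [Complex.polarCoord_symm_apply, Complex.exp_mul_I]
    push_cast
    rfl
  simp only [hs, smul_eq_mul]
  rw [polarCoord_target, MeasureTheory.Measure.volume_eq_prod, ← MeasureTheory.Measure.prod_restrict,
    MeasureTheory.lintegral_prod_symm]
  · refine MeasureTheory.lintegral_congr fun θ => ?_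
    rw [← MeasureTheory.lintegral_indicator measurableSet_Ioi,
      ← MeasureTheory.lintegral_indicator measurableSet_Ioo]
    refine MeasureTheory.lintegral_congr fun t => ?_
    by_cases ht : 0 < t
    · by_cases h : r < t ∧ t < 1
      · simp [Set.indicator, ht, h, Complex.norm_exp_ofReal_mul_I, abs_of_pos ht]
      · simp [Set.indicator, ht, h, Complex.norm_exp_ofReal_mul_I, abs_of_pos ht]
    · have h : ¬ (r < t ∧ t < 1) := fun h => ht (hr.trans h.1)
      simp [Set.indicator, ht, h]
  · exact (Measurable.mul (measurable_fst.ennreal_ofReal) (hG.comp hexp)).aemeasurable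

theorem lintegral_inv_Ioo {r : ℝ} (hr : 0 < r) (hr1 : r < 1) :
    ∫⁻ t in Set.Ioo r 1, ENNReal.ofReal t⁻¹ = ENNReal.ofReal (-Real.log r) := by
  have h0 : (0 : ℝ) ∉ Set.uIcc r 1 := by
    rw [Set.uIcc_of_le hr1.le]; exact fun h => absurd h.1 (not_le.2 hr)
  have hi : IntervalIntegrable (fun t : ℝ => t⁻¹) MeasureTheory.volume r 1 :=
    intervalIntegral.intervalIntegrable_inv (fun x hx h => h0 (h ▸ hx)) continuousOn_id
  have hi' : MeasureTheory.IntegrableOn (fun t : ℝ => t⁻¹) (Set.Ioo r 1) MeasureTheory.volume :=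
    ((intervalIntegrable_iff_integrableOn_Ioc_of_le hr1.le).1 hi).mono_set Set.Ioo_subset_Ioc_self
  rw [← MeasureTheory.ofReal_integral_eq_lintegral_ofReal hi']
  · rw [← MeasureTheory.integral_Ioc_eq_integral_Ioo, ← intervalIntegral.integral_of_le hr1.le,
      integral_inv h0, one_div, Real.log_inv]
  · filter_upwards [MeasureTheory.ae_restrict_mem measurableSet_Ioo] with t ht
    exact inv_nonneg.2 (hr.trans ht.1).le

theorem radial_estimate {r : ℝ} (hr : 0 < r) (hr1 : r < 1) {U : ℂ → ℝ} (hU : Continuous U)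
    (hd : ContDiffOn ℝ 1 U {z : ℂ | r < ‖z‖ ∧ ‖z‖ < 1}) {e : ℂ} (he : ‖e‖ = 1)
    (h1 : |U e - U (r * e)| = 1) :
    1 ≤ ENNReal.ofReal (-Real.log r) *
      ∫⁻ t in Set.Ioo r 1, ENNReal.ofReal t * ‖fderiv ℝ U (t * e)‖ₑ ^ 2 := by
  have hA : IsOpen {z : ℂ | r < ‖z‖ ∧ ‖z‖ < 1} :=
    (isOpen_lt continuous_const continuous_norm).inter
      (isOpen_lt continuous_norm continuous_const)
  have hmem : ∀ t ∈ Set.Ioo r 1, (t : ℂ) * e ∈ {z : ℂ | r < ‖z‖ ∧ ‖z‖ < 1} := by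
    intro t ht
    have := hr.trans ht.1
    simpa [he, abs_of_pos this] using ht
  have hH : Measurable fun t : ℝ => ‖fderiv ℝ U (t * e)‖ₑ :=
    ((measurable_fderiv ℝ U).comp (Continuous.measurable (by fun_prop))).enorm
  have hder : ∀ t ∈ Set.Ioo r 1,
      HasDerivAt (fun s : ℝ => U (s * e)) (fderiv ℝ U (t * e) e) t := by
    intro t ht
    have h := ((hd.differentiableOn one_ne_zero).differentiableAt
      (hA.mem_nhds (hmem t ht))).hasFDerivAt
    have h2 : HasDerivAt (fun s : ℝ => (s : ℂ) * e) e t := by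
      simpa using (Complex.ofRealCLM.hasDerivAt (x := t)).mul_const e
    exact h.comp_hasDerivAt t h2
  have hle : ∀ t : ℝ, ‖fderiv ℝ U (t * e) e‖ₑ ≤ ‖fderiv ℝ U (t * e)‖ₑ := by
    intro t
    have := (fderiv ℝ U (t * e)).le_opNorm e
    rw [he, mul_one] at this
    exact enorm_le_iff_norm_le.2 this
  have hmeas : Measurable fun t : ℝ => fderiv ℝ U (t * e) e :=
    (measurable_fderiv_apply_const ℝ U e).comp (Continuous.measurable (by fun_prop))
  have key : 1 ≤ ∫⁻ t in Set.Ioo r 1, ‖fderiv ℝ U (t * e)‖ₑ := by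
    by_cases hfin : ∫⁻ t in Set.Ioo r 1, ‖fderiv ℝ U (t * e) e‖ₑ = ⊤
    · exact le_trans (by simp [hfin]) (MeasureTheory.lintegral_mono hle)
    · have hint : MeasureTheory.IntegrableOn (fun t : ℝ => fderiv ℝ U (t * e) e) (Set.Ioo r 1) :=
        ⟨hmeas.aestronglyMeasurable, lt_top_iff_ne_top.2 hfin⟩
      have hftc := intervalIntegral.integral_eq_sub_of_hasDerivAt_of_le hr1.le
        (Continuous.continuousOn (by fun_prop)) hder
        ((intervalIntegrable_iff_integrableOn_Ioo_of_le hr1.le).2 hint)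
      rw [intervalIntegral.integral_of_le hr1.le, MeasureTheory.integral_Ioc_eq_integral_Ioo] at hftc
      have h2 := MeasureTheory.enorm_integral_le_lintegral_enorm
        (μ := MeasureTheory.volume.restrict (Set.Ioo r 1)) (fun t : ℝ => fderiv ℝ U (t * e) e)
      rw [hftc] at h2
      have h3 : ‖U (((1 : ℝ) : ℂ) * e) - U (r * e)‖ₑ = 1 := by
        rw [Real.enorm_eq_ofReal_abs]
        simp [h1]
      rw [h3] at h2
      exact h2.trans (MeasureTheory.lintegral_mono hle)
  have hcs := ENNReal.lintegral_mul_le_Lp_mul_Lq (MeasureTheory.volume.restrict (Set.Ioo r 1))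
    Real.HolderConjugate.two_two
    (f := fun t => ENNReal.ofReal t⁻¹ ^ (1 / 2 : ℝ))
    (g := fun t => ENNReal.ofReal t ^ (1 / 2 : ℝ) * ‖fderiv ℝ U (t * e)‖ₑ)
    (by fun_prop) (by fun_prop)
  have e1 : ∫⁻ t in Set.Ioo r 1, ‖fderiv ℝ U (t * e)‖ₑ = ∫⁻ t in Set.Ioo r 1,
      ((fun t : ℝ => ENNReal.ofReal t⁻¹ ^ (1 / 2 : ℝ)) *
        fun t : ℝ => ENNReal.ofReal t ^ (1 / 2 : ℝ) * ‖fderiv ℝ U (t * e)‖ₑ) t := by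
    refine MeasureTheory.setLIntegral_congr_fun measurableSet_Ioo fun t ht => ?_
    have ht0 : 0 < t := hr.trans ht.1
    simp only [Pi.mul_apply]
    rw [← mul_assoc, ← ENNReal.mul_rpow_of_nonneg _ _ (by norm_num),
      ← ENNReal.ofReal_mul (inv_nonneg.2 ht0.le), inv_mul_cancel₀ ht0.ne']
    simp
  have e2 : ∀ t : ℝ, (ENNReal.ofReal t⁻¹ ^ (1 / 2 : ℝ)) ^ (2 : ℝ) = ENNReal.ofReal t⁻¹ := by
    intro t
    rw [← ENNReal.rpow_mul]; norm_num
  have e3 : ∀ t : ℝ, (ENNReal.ofReal t ^ (1 / 2 : ℝ) * ‖fderiv ℝ U (t * e)‖ₑ) ^ (2 : ℝ) =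
      ENNReal.ofReal t * ‖fderiv ℝ U (t * e)‖ₑ ^ 2 := by
    intro t
    rw [ENNReal.mul_rpow_of_nonneg _ _ (by norm_num), ← ENNReal.rpow_mul]
    norm_num
  simp only [e2, e3] at hcs
  rw [← e1, lintegral_inv_Ioo hr hr1, ← ENNReal.mul_rpow_of_nonneg _ _ (by norm_num)] at hcs
  have h4 := key.trans hcs
  have h5 := ENNReal.rpow_le_rpow h4 (z := 2) (by norm_num)
  rw [← ENNReal.rpow_mul] at h5
  simpa using h5

/-- The round annulus `r < |z| < 1` in the sphere. -/
def roundAnnulus (r : ℝ) : Set Sphere := (fun z : ℂ => (z : Sphere)) '' {z | r < ‖z‖ ∧ ‖z‖ < 1}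

theorem coe_preimage_roundAnnulus (r : ℝ) :
    {z : ℂ | (z : Sphere) ∈ roundAnnulus r} = {z | r < ‖z‖ ∧ ‖z‖ < 1} :=
  Set.preimage_image_eq _ OnePoint.coe_injective

theorem isConnected_compl_ball : IsConnected ((fun z : ℂ => (z : Sphere)) '' Metric.ball 0 1)ᶜ := by
  have h1 : IsConnected ((fun z : ℂ => (z : Sphere)) '' {z : ℂ | ‖z‖ ∈ Set.Ici (1 : ℝ)}) :=
    (isConnected_norm_mem isConnected_Ici fun t ht => zero_le_one.trans ht).image _
      OnePoint.continuous_coe.continuousOn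
  refine h1.subset_closure ?_ ?_
  · rintro _ ⟨z, hz, rfl⟩ ⟨w, hw, hwz⟩
    rw [OnePoint.coe_injective hwz, mem_ball_zero_iff] at hw
    exact absurd hw (not_lt.2 hz)
  · intro x hx
    induction x using OnePoint.rec with
    | infty =>
      rw [mem_closure_iff]
      intro o ho hmem
      obtain ⟨hc, -⟩ := (OnePoint.isOpen_iff_of_mem' hmem).1 ho
      obtain ⟨R, hR⟩ := hc.isBounded.subset_closedBall 0
      refine ⟨((max 1 (R + 1) : ℝ) : ℂ), ?_, _, ?_, rfl⟩
      · by_contra h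
        have := hR h
        rw [mem_closedBall_zero_iff, Complex.norm_real, Real.norm_eq_abs] at this
        have h2 := (le_abs_self _).trans this
        linarith [le_max_right 1 (R + 1)]
      · simp only [Set.mem_ofPred_eq, Set.mem_Ici, Complex.norm_real, Real.norm_eq_abs]
        exact (le_max_left _ _).trans (le_abs_self _)
    | coe z =>
      refine subset_closure ⟨z, ?_, rfl⟩
      by_contra h
      exact hx ⟨z, by simpa using h, rfl⟩

theorem isAnnulus_roundAnnulus {r : ℝ} (hr : 0 < r) (hr1 : r < 1) :
    IsAnnulus (roundAnnulus r) ((fun z : ℂ => (z : Sphere)) '' Metric.closedBall 0 r)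
      ((fun z : ℂ => (z : Sphere)) '' Metric.ball 0 1)ᶜ where
  isConnected := (isConnected_norm_mem (isConnected_Ioo hr1)
    fun t ht => (hr.trans ht.1).le).image _ OnePoint.continuous_coe.continuousOn
  isClosed_left := OnePoint.isClosed_image_coe.2
    ⟨Metric.isClosed_closedBall, isCompact_closedBall 0 r⟩
  isClosed_right := (OnePoint.isOpen_image_coe.2 Metric.isOpen_ball).isClosed_compl
  isConnected_left := ((convex_closedBall 0 r).isConnected
    (Metric.nonempty_closedBall.2 hr.le)).image _ OnePoint.continuous_coe.continuousOn
  isConnected_right := isConnected_compl_ball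
  disjoint := by
    rw [Set.disjoint_compl_right_iff_subset]
    exact Set.image_mono (Metric.closedBall_subset_ball hr1)
  compl_eq := by
    ext x
    induction x using OnePoint.rec with
    | infty => simp [roundAnnulus]
    | coe z =>
      simp only [roundAnnulus, Set.mem_compl_iff, Set.mem_union,
        Set.InjOn.mem_image_iff OnePoint.coe_injective.injOn (Set.subset_univ _) (Set.mem_univ _),
        mem_closedBall_zero_iff, mem_ball_zero_iff, Set.mem_ofPred_eq]
      grind

theorem capacity_roundAnnulus_ge {r : ℝ} (hr : 0 < r) (hr1 : r < 1) :
    ENNReal.ofReal (2 * Real.pi) / ENNReal.ofReal (-Real.log r) ≤ capacity (roundAnnulus r) := by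
  refine le_iInf fun u => le_iInf fun hu => ?_
  obtain ⟨hc, hd, E, F, hEF, hE, hF⟩ := hu
  have hR := isAnnulus_roundAnnulus hr hr1
  rw [coe_preimage_roundAnnulus] at hd ⊢
  rw [lintegral_annulus hr ((measurable_fderiv ℝ _).enorm.pow_const 2)]
  have hun := hR.compl_eq.symm.trans hEF.compl_eq
  have hdis : ∀ s : Set Sphere, IsConnected s → s ⊆ E ∪ F → s ⊆ E ∨ s ⊆ F := fun s hs h =>
    isPreconnected_iff_subset_of_disjoint_closed.1 hs.isPreconnected E F hEF.isClosed_left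
      hEF.isClosed_right h (by rw [hEF.disjoint.inter_eq, Set.inter_empty])
  have hval : ∀ θ : ℝ, |u ((Complex.exp (θ * Complex.I) : ℂ) : Sphere) -
      u ((r * Complex.exp (θ * Complex.I) : ℂ) : Sphere)| = 1 := by
    intro θ
    have ha : ((Complex.exp (θ * Complex.I) : ℂ) : Sphere) ∈
        ((fun z : ℂ => (z : Sphere)) '' Metric.ball 0 1)ᶜ := by
      rintro ⟨w, hw, h⟩
      rw [OnePoint.coe_injective h, mem_ball_zero_iff, Complex.norm_exp_ofReal_mul_I] at hw
      exact lt_irrefl _ hw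
    have hb : ((r * Complex.exp (θ * Complex.I) : ℂ) : Sphere) ∈
        (fun z : ℂ => (z : Sphere)) '' Metric.closedBall 0 r :=
      ⟨_, by simp [Complex.norm_exp_ofReal_mul_I, abs_of_pos hr], rfl⟩
    rcases hdis _ hR.isConnected_left (hun ▸ Set.subset_union_left) with h1 | h1 <;>
      rcases hdis _ hR.isConnected_right (hun ▸ Set.subset_union_right) with h2 | h2
    · exfalso
      obtain ⟨y, hy⟩ := hEF.isConnected_right.nonempty
      have : y ∈ E := (Set.union_subset h1 h2) (hun ▸ Set.mem_union_right E hy)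
      exact Set.disjoint_left.1 hEF.disjoint this hy
    · rw [hE _ (h1 hb), hF _ (h2 ha)]; norm_num
    · rw [hF _ (h1 hb), hE _ (h2 ha)]; norm_num
    · exfalso
      obtain ⟨y, hy⟩ := hEF.isConnected_left.nonempty
      have : y ∈ F := (Set.union_subset h1 h2) (hun ▸ Set.mem_union_left F hy)
      exact Set.disjoint_left.1 hEF.disjoint hy this
  have hest : ∀ θ : ℝ, (ENNReal.ofReal (-Real.log r))⁻¹ ≤ ∫⁻ t in Set.Ioo r 1, ENNReal.ofReal t *
      ‖fderiv ℝ (fun w : ℂ => u w) (t * Complex.exp (θ * Complex.I))‖ₑ ^ 2 := by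
    intro θ
    have := radial_estimate hr hr1 (hc.comp OnePoint.continuous_coe) hd
      (Complex.norm_exp_ofReal_mul_I θ) (hval θ)
    exact ENNReal.inv_le_iff_le_mul (fun _ => by simp [Real.log_neg hr hr1]) (fun h => absurd h (by simp)) |>.2 this
  calc ENNReal.ofReal (2 * Real.pi) / ENNReal.ofReal (-Real.log r)
      = ∫⁻ _ in Set.Ioo (-Real.pi) Real.pi, (ENNReal.ofReal (-Real.log r))⁻¹ := by
        rw [MeasureTheory.setLIntegral_const, Real.volume_Ioo, mul_comm, ENNReal.div_eq_inv_mul,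
          mul_comm]
        ring_nf
    _ ≤ _ := MeasureTheory.lintegral_mono hest

/-- The potential theoretic extremal function of the round annulus. -/
def roundFun (r : ℝ) (z : ℂ) : ℝ := min 1 (1 - Real.log (max r ‖z‖) / Real.log r)

theorem roundFun_of_one_le {r : ℝ} (hr : 0 < r) (hr1 : r < 1) {z : ℂ} (hz : 1 ≤ ‖z‖) :
    roundFun r z = 1 := by
  have h1 : 0 ≤ Real.log (max r ‖z‖) := Real.log_nonneg (hz.trans (le_max_right _ _))
  have h2 := div_nonpos_of_nonneg_of_nonpos h1 (Real.log_neg hr hr1).le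
  exact min_eq_left (by linarith)

theorem isAdmissible_roundFun {r : ℝ} (hr : 0 < r) (hr1 : r < 1) :
    IsAdmissible (roundAnnulus r) (fun x => OnePoint.elim x 1 (roundFun r)) := by
  have hl : Real.log r < 0 := Real.log_neg hr hr1
  have hcont : Continuous (roundFun r) := by
    refine continuous_const.min (continuous_const.sub (Continuous.div_const ?_ _))
    exact Continuous.log (by fun_prop) fun z => (hr.trans_le (le_max_left _ _)).ne'
  refine ⟨?_, ?_, _, _, isAnnulus_roundAnnulus hr hr1, ?_, ?_⟩
  · rw [OnePoint.continuous_iff]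
    refine ⟨?_, hcont⟩
    refine tendsto_const_nhds.congr' ?_
    have : ∀ᶠ z in Filter.coclosedCompact ℂ, 1 ≤ ‖z‖ := by
      rw [Filter.coclosedCompact_eq_cocompact]
      exact (tendsto_norm_cocompact_atTop (E := ℂ)).eventually_ge_atTop 1
    filter_upwards [this] with z hz
    exact (roundFun_of_one_le hr hr1 hz).symm
  · rw [coe_preimage_roundAnnulus]
    have : ContDiffOn ℝ 1 (fun z : ℂ => 1 - Real.log ‖z‖ / Real.log r)
        {z : ℂ | r < ‖z‖ ∧ ‖z‖ < 1} := by
      refine contDiffOn_const.sub (ContDiffOn.div_const (ContDiffOn.log ?_ ?_) _)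
      · exact contDiffOn_id.norm ℝ fun z hz => norm_pos_iff.1 (hr.trans hz.1)
      · exact fun z hz => (hr.trans hz.1).ne'
    refine this.congr fun z hz => ?_
    have h2 : 0 ≤ Real.log ‖z‖ / Real.log r :=
      div_nonneg_of_nonpos (Real.log_nonpos (norm_nonneg _) hz.2.le) hl.le
    simp only [OnePoint.elim_some, roundFun, max_eq_right hz.1.le]
    exact min_eq_right (by linarith)
  · rintro _ ⟨z, hz, rfl⟩
    rw [mem_closedBall_zero_iff] at hz
    simp [roundFun, max_eq_left hz, div_self hl.ne]
  · intro x hx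
    induction x using OnePoint.rec with
    | infty => rfl
    | coe z =>
      refine roundFun_of_one_le hr hr1 ?_
      by_contra h
      exact hx ⟨z, by simpa using h, rfl⟩

theorem capacity_roundAnnulus_le {r : ℝ} (hr : 0 < r) (hr1 : r < 1) :
    capacity (roundAnnulus r) ≤ ENNReal.ofReal (2 * Real.pi) / ENNReal.ofReal (-Real.log r) := by
  have hl : Real.log r < 0 := Real.log_neg hr hr1
  have hL : 0 < -Real.log r := neg_pos.2 hl
  refine (iInf₂_le _ (isAdmissible_roundFun hr hr1)).trans ?_
  rw [coe_preimage_roundAnnulus, lintegral_annulus hr ((measurable_fderiv ℝ _).enorm.pow_const 2)]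
  have hA : IsOpen {z : ℂ | r < ‖z‖ ∧ ‖z‖ < 1} :=
    (isOpen_lt continuous_const continuous_norm).inter
      (isOpen_lt continuous_norm continuous_const)
  have hbound : ∀ z : ℂ, r < ‖z‖ ∧ ‖z‖ < 1 →
      ‖fderiv ℝ (fun w : ℂ => OnePoint.elim (w : Sphere) 1 (roundFun r)) z‖ₑ ≤
        ENNReal.ofReal (‖z‖⁻¹ * (-Real.log r)⁻¹) := by
    intro z hz
    have hz0 : z ≠ 0 := norm_pos_iff.1 (hr.trans hz.1)
    have heq : (fun w : ℂ => OnePoint.elim (w : Sphere) 1 (roundFun r)) =ᶠ[nhds z]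
        fun w : ℂ => 1 - Real.log ‖w‖ / Real.log r := by
      filter_upwards [hA.mem_nhds hz] with w hw
      have h2 : 0 ≤ Real.log ‖w‖ / Real.log r :=
        div_nonneg_of_nonpos (Real.log_nonpos (norm_nonneg _) hw.2.le) hl.le
      simp only [OnePoint.elim_some, roundFun, max_eq_right hw.1.le]
      exact min_eq_right (by linarith)
    have hn : HasFDerivAt (fun w : ℂ => ‖w‖) (fderiv ℝ (fun w : ℂ => ‖w‖) z) z :=
      (differentiableAt_id.norm ℝ hz0).hasFDerivAt
    have hd := ((hn.log (norm_ne_zero_iff.2 hz0)).mul_const (Real.log r)⁻¹).const_sub 1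
    have hd' : HasFDerivAt (fun w : ℂ => 1 - Real.log ‖w‖ / Real.log r) _ z := hd
    rw [heq.fderiv_eq, hd'.fderiv]
    have hlip : ‖fderiv ℝ (fun w : ℂ => ‖w‖) z‖ ≤ 1 := by
      simpa using norm_fderiv_le_of_lipschitz ℝ (x₀ := z) (lipschitzWith_one_norm (E := ℂ))
    rw [← ofReal_norm]
    refine ENNReal.ofReal_le_ofReal ?_
    rw [norm_neg, norm_smul, norm_smul, norm_inv, norm_inv, norm_norm, Real.norm_eq_abs,
      abs_of_neg hl]
    have : 0 ≤ ‖z‖⁻¹ := by positivity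
    have h3 : 0 ≤ (-Real.log r)⁻¹ := by positivity
    calc (-Real.log r)⁻¹ * (‖z‖⁻¹ * ‖fderiv ℝ (fun w : ℂ => ‖w‖) z‖)
        ≤ (-Real.log r)⁻¹ * (‖z‖⁻¹ * 1) := by gcongr
      _ = _ := by ring
  have hin : ∀ θ : ℝ, ∫⁻ t in Set.Ioo r 1, ENNReal.ofReal t *
      ‖fderiv ℝ (fun w : ℂ => OnePoint.elim (w : Sphere) 1 (roundFun r))
        (t * Complex.exp (θ * Complex.I))‖ₑ ^ 2 ≤ (ENNReal.ofReal (-Real.log r))⁻¹ := by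
    intro θ
    calc _ ≤ ∫⁻ t in Set.Ioo r 1, ENNReal.ofReal ((-Real.log r)⁻¹ ^ 2) * ENNReal.ofReal t⁻¹ := by
          refine MeasureTheory.setLIntegral_mono' measurableSet_Ioo fun t ht => ?_
          have ht0 : 0 < t := hr.trans ht.1
          have hnorm : ‖(t : ℂ) * Complex.exp (θ * Complex.I)‖ = t := by
            simp [Complex.norm_exp_ofReal_mul_I, abs_of_pos ht0]
          have hb := hbound (t * Complex.exp (θ * Complex.I)) (by rw [hnorm]; exact ht)
          rw [hnorm] at hb
          calc _ ≤ ENNReal.ofReal t * ENNReal.ofReal (t⁻¹ * (-Real.log r)⁻¹) ^ 2 := by gcongr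
            _ = _ := by
              rw [← ENNReal.ofReal_pow (by positivity), ← ENNReal.ofReal_mul ht0.le,
                ← ENNReal.ofReal_mul (by positivity)]
              congr 1
              field_simp
      _ = (ENNReal.ofReal (-Real.log r))⁻¹ := by
          rw [MeasureTheory.lintegral_const_mul _ (by fun_prop), lintegral_inv_Ioo hr hr1,
            ← ENNReal.ofReal_mul (by positivity), ← ENNReal.ofReal_inv_of_pos hL]
          congr 1
          field_simp
  calc _ ≤ ∫⁻ _ in Set.Ioo (-Real.pi) Real.pi, (ENNReal.ofReal (-Real.log r))⁻¹ :=
        MeasureTheory.lintegral_mono hin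
    _ = _ := by
        rw [MeasureTheory.setLIntegral_const, Real.volume_Ioo, mul_comm, ENNReal.div_eq_inv_mul,
          mul_comm]
        ring_nf

/-- The normalization of the modulus: the round annulus `r < |z| < 1` has modulus `-log r`. -/
theorem modulus_roundAnnulus {r : ℝ} (hr : 0 < r) (hr1 : r < 1) :
    modulus (roundAnnulus r) = ENNReal.ofReal (-Real.log r) := by
  have hL : 0 < -Real.log r := neg_pos.2 (Real.log_neg hr hr1)
  have hp : 0 < 2 * Real.pi := by positivity
  rw [modulus, le_antisymm (capacity_roundAnnulus_le hr hr1) (capacity_roundAnnulus_ge hr hr1),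
    ← ENNReal.ofReal_div_of_pos hL, ← ENNReal.ofReal_div_of_pos (by positivity)]
  congr 1
  field_simp

end Normalization

end MarkedDisc

end

noncomputable section

namespace MarkedDisc

open Set Filter Topology MeasureTheory

/-! ### Injective holomorphic functions in the plane -/

/-! A conformal representation `χ` carries the annulus between the boundary of `D` and `{|χ| = r}`
onto `r < |w| < 1`. The Dirichlet integral is conformally invariant, so the potential of this
equipotential is `-log r` (`potential_eq`). Between two equipotentials lies the complement of the
two closed discs that they bound (`annulusBetween_equipotentials`). Since the modulus is `2π / cap`,
both inequalities become estimates of the capacity of that complement.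

Lower bound of the modulus (`capacity_between_le`): for each disc take the function that is `0` on
the closed disc, `1` off `D_i`, and a smoothed multiple of `log |χ_i|` plus a constant in between
(`testFun`). Its energy is nearly `2π / v_i`. Combining the two with weights `v_i / (v₁ + v₂)` gives
an admissible function. The gradients live on disjoint collars, so the energies add up to nearly `2π
/ (v₁ + v₂)`. The smoothing makes the functions locally constant near the boundaries of the discs,
so these boundaries may be arbitrary.

Upper bound (`le_capacity_between`): a Möbius coordinate `w` puts `z₁` at `0` and `z₂` at `∞`. Then
`|w| < ρ₁` lies in `D₁` and `|w| > 1/ρ₂` lies in `D₂`. By Schwarz's lemma (`moebius_mem_core`), `|w|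
≤ ρ₁ r₁` and `|w| ≥ 1/(ρ₂ r₂)` lie in the closed discs bounded by the equipotentials. Every radius
of the round annulus `ρ₁ r₁ < |w| < 1/(ρ₂ r₂)` thus joins these discs. The length-area method
(`length_area`) bounds the modulus by that of the round annulus, namely `v₁ + v₂ - log ρ₁ - log ρ₂`.
-/

theorem nhds_le_map_of_injOn {f : ℂ → ℂ} {U : Set ℂ} (hU : IsOpen U) (hf : DifferentiableOn ℂ f U)
    (hi : InjOn f U) {z : ℂ} (hz : z ∈ U) : 𝓝 (f z) ≤ map f (𝓝 z) := by
  have ha : AnalyticAt ℂ f z := hf.analyticAt (hU.mem_nhds hz)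
  rcases ha.eventually_constant_or_nhds_le_map_nhds with h | h
  · exfalso
    have h2 : ∀ᶠ w in 𝓝[≠] z, False := by
      filter_upwards [nhdsWithin_le_nhds h, nhdsWithin_le_nhds (hU.mem_nhds hz),
        self_mem_nhdsWithin] with w hw hwU hne
      exact hne (hi hwU hz hw)
    simp only [eventually_false_iff_eq_bot] at h2
    exact (NormedField.nhdsNE_neBot z).ne h2
  · exact h

theorem isOpen_image_of_injOn {f : ℂ → ℂ} {U : Set ℂ} (hU : IsOpen U)
    (hf : DifferentiableOn ℂ f U) (hi : InjOn f U) : IsOpen (f '' U) := by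
  rw [isOpen_iff_mem_nhds]
  rintro _ ⟨z, hz, rfl⟩
  exact nhds_le_map_of_injOn hU hf hi hz (image_mem_map (hU.mem_nhds hz))

theorem continuousAt_of_leftInverse {f g : ℂ → ℂ} {U : Set ℂ} (hU : IsOpen U)
    (hf : DifferentiableOn ℂ f U) (hg : ∀ z ∈ U, g (f z) = z) {z : ℂ} (hz : z ∈ U) :
    ContinuousAt g (f z) := by
  have hi : InjOn f U := fun x hx y hy h => by rw [← hg x hx, ← hg y hy, h]
  rw [ContinuousAt, hg z hz]
  refine Tendsto.mono_left ?_ (nhds_le_map_of_injOn hU hf hi hz)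
  rw [tendsto_map'_iff]
  refine tendsto_id.congr' ?_
  filter_upwards [hU.mem_nhds hz] with w hw
  exact (hg w hw).symm

/-- Where `f' ≠ 0` this is the inverse function theorem. The zeros of `f'` are isolated, as
otherwise `f` would be locally constant and not injective. So `g` is holomorphic in a punctured
neighbourhood of `f z` and continuous at `f z`, and the singularity is removable. -/
theorem differentiableAt_of_leftInverse {f g : ℂ → ℂ} {U : Set ℂ} (hU : IsOpen U)
    (hf : DifferentiableOn ℂ f U) (hg : ∀ z ∈ U, g (f z) = z) {z : ℂ} (hz : z ∈ U) :
    DifferentiableAt ℂ g (f z) := by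
  have hi : InjOn f U := fun x hx y hy h => by rw [← hg x hx, ← hg y hy, h]
  have hmap := fun {w : ℂ} (hw : w ∈ U) => nhds_le_map_of_injOn hU hf hi hw
  have hfa : AnalyticOnNhd ℂ f U := hf.analyticOnNhd hU
  have hright : ∀ w ∈ U, ∀ᶠ y in 𝓝 (f w), f (g y) = y := by
    intro w hw
    refine hmap hw ?_
    rw [mem_map]
    filter_upwards [hU.mem_nhds hw] with x hx
    simp [hg x hx]
  have hreg : ∀ w ∈ U, deriv f w ≠ 0 → DifferentiableAt ℂ g (f w) := by
    intro w hw hne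
    have hd : HasDerivAt f (deriv f w) (g (f w)) := by
      rw [hg w hw]; exact (hfa w hw).differentiableAt.hasDerivAt
    exact (HasDerivAt.of_local_left_inverse (continuousAt_of_leftInverse hU hf hg hw) hd hne
      (hright w hw)).differentiableAt
  refine (Complex.analyticAt_of_differentiable_on_punctured_nhds_of_continuousAt ?_
    (continuousAt_of_leftInverse hU hf hg hz)).differentiableAt
  have hev : ∀ᶠ w in 𝓝[≠] z, deriv f w ≠ 0 := by
    rcases (hfa z hz).deriv.eventually_eq_zero_or_eventually_ne_zero with h | h
    · exfalso
      obtain ⟨ε, hε, hball⟩ := Metric.eventually_nhds_iff_ball.1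
        (h.and (hU.mem_nhds hz))
      have hc : ∀ w ∈ Metric.ball z ε, f w = f z := by
        intro w hw
        refine (convex_ball z ε).is_const_of_fderivWithin_eq_zero (𝕜 := ℂ)
          (fun x hx => (hfa x (hball x hx).2).differentiableAt.differentiableWithinAt) ?_ hw
          (Metric.mem_ball_self hε)
        intro x hx
        rw [fderivWithin_of_isOpen Metric.isOpen_ball hx]
        ext
        simpa using (hball x hx).1
      have h2 : (z + (ε / 2 : ℝ) : ℂ) ∈ Metric.ball z ε := by
        simp [abs_of_pos hε, hε]
      have h3 := hi (hball _ h2).2 hz (hc _ h2)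
      have : ε = 0 := by simpa using h3
      exact hε.ne' this
    · exact h
  rw [eventually_nhdsWithin_iff] at hev ⊢
  refine hmap hz ?_
  rw [mem_map]
  filter_upwards [hev, hU.mem_nhds hz] with w hw hwU hne
  exact hreg w hwU (hw fun h => hne (by simp [mem_singleton_iff.1 h]))

/-! ### Coordinates on the sphere -/

theorem chartInfty_zero : chartInfty 0 = OnePoint.infty := if_pos rfl

theorem chartInfty_of_ne {w : ℂ} (hw : w ≠ 0) : chartInfty w = ((w⁻¹ : ℂ) : Sphere) := if_neg hw

theorem chartInfty_injective : Function.Injective chartInfty := by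
  intro x y h
  unfold chartInfty at h
  split_ifs at h with hx hy hy
  · rw [hx, hy]
  · exact absurd h (OnePoint.infty_ne_coe _)
  · exact absurd h (OnePoint.coe_ne_infty _)
  · exact inv_injective (OnePoint.coe_injective h)

theorem continuous_chartInfty : Continuous chartInfty := by
  rw [continuous_iff_continuousAt]
  intro w
  by_cases hw : w = 0
  · subst hw
    rw [continuousAt_iff_punctured_nhds, chartInfty_zero]
    have h1 : Tendsto (fun z : ℂ => (z : Sphere)) (coclosedCompact ℂ) (𝓝 OnePoint.infty) := by
      refine Tendsto.mono_right tendsto_map ?_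
      rw [← OnePoint.nhdsNE_infty_eq]
      exact nhdsWithin_le_nhds
    rw [coclosedCompact_eq_cocompact, ← Metric.cobounded_eq_cocompact] at h1
    refine (h1.comp tendsto_inv₀_nhdsNE_zero).congr' ?_
    filter_upwards [self_mem_nhdsWithin] with x hx
    exact (chartInfty_of_ne hx).symm
  · refine ((OnePoint.continuous_coe.continuousAt).comp (continuousAt_inv₀ hw)).congr ?_
    filter_upwards [isOpen_ne.mem_nhds hw] with x hx
    exact (chartInfty_of_ne hx).symm

/-- The inversion `z ↦ 1 / z` of the sphere. -/
def inversion (x : Sphere) : Sphere := OnePoint.elim x ((0 : ℂ) : Sphere) chartInfty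

theorem inversion_coe (z : ℂ) : inversion z = chartInfty z := rfl

theorem inversion_inversion (x : Sphere) : inversion (inversion x) = x := by
  induction x using OnePoint.rec with
  | infty => exact chartInfty_zero
  | coe z =>
    by_cases hz : z = 0
    · subst hz; rw [inversion_coe, chartInfty_zero]; rfl
    · rw [inversion_coe, chartInfty_of_ne hz, inversion_coe, chartInfty_of_ne (inv_ne_zero hz),
        inv_inv]

theorem continuous_inversion : Continuous inversion := by
  rw [OnePoint.continuous_iff]
  refine ⟨?_, continuous_chartInfty⟩
  have h : Tendsto (fun z : ℂ => ((z⁻¹ : ℂ) : Sphere)) (coclosedCompact ℂ)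
      (𝓝 ((0 : ℂ) : Sphere)) := by
    rw [coclosedCompact_eq_cocompact, ← Metric.cobounded_eq_cocompact]
    exact OnePoint.continuous_coe.continuousAt.tendsto.comp tendsto_inv₀_cobounded
  refine h.congr' ?_
  have h2 : ∀ᶠ z in coclosedCompact ℂ, z ≠ 0 := by
    rw [coclosedCompact_eq_cocompact, ← Metric.cobounded_eq_cocompact]
    exact Bornology.isBounded_singleton
  filter_upwards [h2] with z hz
  exact (chartInfty_of_ne hz).symm

theorem isOpenEmbedding_chartInfty : IsOpenEmbedding chartInfty := by
  let e : Sphere ≃ₜ Sphere :=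
    ⟨⟨inversion, inversion, inversion_inversion, inversion_inversion⟩,
      continuous_inversion, continuous_inversion⟩
  -- By definition, `chartInfty` is the inversion composed with the inclusion of the plane.
  exact e.isOpenEmbedding.comp OnePoint.isOpenEmbedding_coe

theorem exists_chart (x : Sphere) : (∃ z : ℂ, x = z) ∨ ∃ w : ℂ, x = chartInfty w := by
  induction x using OnePoint.rec with
  | infty => exact Or.inr ⟨0, chartInfty_zero.symm⟩
  | coe z => exact Or.inl ⟨z, rfl⟩

/-- The affine coordinate of a point of the sphere. -/
def affine (x : Sphere) : ℂ := OnePoint.elim x 0 id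

theorem affine_coe (z : ℂ) : affine z = z := rfl

theorem coe_affine {x : Sphere} (hx : x ≠ OnePoint.infty) : (affine x : Sphere) = x := by
  induction x using OnePoint.rec with
  | infty => exact absurd rfl hx
  | coe z => rfl


/-! ### Möbius transformations -/

/-- The point of the sphere with homogeneous coordinates `(p : q)`. -/
def pt (p q : ℂ) : Sphere := if q = 0 then OnePoint.infty else ((p / q : ℂ) : Sphere)

theorem pt_of_ne (p : ℂ) {q : ℂ} (hq : q ≠ 0) : pt p q = ((p / q : ℂ) : Sphere) := if_neg hq

theorem pt_eq_chartInfty {p : ℂ} (hp : p ≠ 0) (q : ℂ) : pt p q = chartInfty (q / p) := by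
  by_cases hq : q = 0
  · simp [pt, hq, chartInfty]
  · rw [pt_of_ne p hq, chartInfty_of_ne (div_ne_zero hq hp), inv_div]

theorem pt_eq_infty {p q : ℂ} : pt p q = OnePoint.infty ↔ q = 0 := by
  unfold pt
  split_ifs with h <;> simp [h]

theorem pt_smul {c : ℂ} (hc : c ≠ 0) (p q : ℂ) : pt (c * p) (c * q) = pt p q := by
  unfold pt
  simp [hc, mul_div_mul_left]

theorem pt_eq_pt {p q p' q' : ℂ} (h : pt p q = pt p' q') : p * q' = p' * q := by
  unfold pt at h
  split_ifs at h with h1 h2 h2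
  · simp [h1, h2]
  · exact absurd h (OnePoint.infty_ne_coe _)
  · exact absurd h (OnePoint.coe_ne_infty _)
  · have := OnePoint.coe_injective h
    field_simp at this
    linear_combination this

/-- Homogeneous coordinates treat `∞` like any other point. Distinctness of the points becomes the
nonvanishing of the determinant of a Möbius map. -/
theorem exists_pt {x y : Sphere} (hxy : x ≠ y) :
    ∃ p₁ q₁ p₂ q₂ : ℂ, pt p₁ q₁ = x ∧ pt p₂ q₂ = y ∧ p₁ * q₂ - p₂ * q₁ ≠ 0 := by
  induction x using OnePoint.rec with
  | infty =>
    induction y using OnePoint.rec with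
    | infty => exact absurd rfl hxy
    | coe y => exact ⟨1, 0, y, 1, by simp [pt], by simp [pt], by simp⟩
  | coe x =>
    induction y using OnePoint.rec with
    | infty => exact ⟨x, 1, 1, 0, by simp [pt], by simp [pt], by simp⟩
    | coe y =>
      refine ⟨x, 1, y, 1, by simp [pt], by simp [pt], ?_⟩
      simpa [sub_eq_zero] using fun h => hxy (congrArg _ h)

/-- The Möbius transformation that maps `0` to `(p₁ : q₁)` and `∞` to `(p₂ : q₂)`. -/
def moebius (p₁ q₁ p₂ q₂ w : ℂ) : Sphere := pt (p₁ + w * p₂) (q₁ + w * q₂)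

section Moebius

variable {p₁ q₁ p₂ q₂ : ℂ}

theorem moebius_injective (h : p₁ * q₂ - p₂ * q₁ ≠ 0) :
    Function.Injective (moebius p₁ q₁ p₂ q₂) := by
  intro w w' hw
  have h1 := pt_eq_pt hw
  have h2 : (w - w') * (p₁ * q₂ - p₂ * q₁) = 0 := by linear_combination -h1
  exact sub_eq_zero.1 ((mul_eq_zero.1 h2).resolve_right h)

theorem moebius_num_ne_zero (h : p₁ * q₂ - p₂ * q₁ ≠ 0) {w : ℂ} (hw : q₁ + w * q₂ = 0) :
    p₁ + w * p₂ ≠ 0 := fun h' => h (by linear_combination q₂ * h' - p₂ * hw)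

/-- Inverting the coordinate exchanges the two marks, so whatever is shown near `0` for the first
disc applies near `∞` to the second. -/
theorem moebius_inv {w : ℂ} (hw : w ≠ 0) : moebius p₁ q₁ p₂ q₂ w⁻¹ = moebius p₂ q₂ p₁ q₁ w := by
  rw [moebius, moebius, ← pt_smul hw]
  congr 1 <;> field_simp <;> ring

theorem moebius_eventuallyEq_coe {w : ℂ} (hw : q₁ + w * q₂ ≠ 0) : moebius p₁ q₁ p₂ q₂ =ᶠ[𝓝 w]
    fun w => (((p₁ + w * p₂) / (q₁ + w * q₂) : ℂ) : Sphere) := by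
  have : ContinuousAt (fun w => q₁ + w * q₂) w := by fun_prop
  filter_upwards [this.eventually_ne hw] with x hx
  exact pt_of_ne _ hx

theorem moebius_eventuallyEq_chartInfty {w : ℂ} (hw : p₁ + w * p₂ ≠ 0) :
    moebius p₁ q₁ p₂ q₂ =ᶠ[𝓝 w] fun w => chartInfty ((q₁ + w * q₂) / (p₁ + w * p₂)) := by
  have : ContinuousAt (fun w => p₁ + w * p₂) w := by fun_prop
  filter_upwards [this.eventually_ne hw] with x hx
  exact pt_eq_chartInfty hx _

theorem continuous_moebius (h : p₁ * q₂ - p₂ * q₁ ≠ 0) : Continuous (moebius p₁ q₁ p₂ q₂) := by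
  rw [continuous_iff_continuousAt]
  intro w
  by_cases hw : q₁ + w * q₂ = 0
  · have hp := moebius_num_ne_zero h hw
    refine ContinuousAt.congr ?_ (moebius_eventuallyEq_chartInfty hp).symm
    refine continuous_chartInfty.continuousAt.comp ?_
    fun_prop (disch := assumption)
  · refine ContinuousAt.congr ?_ (moebius_eventuallyEq_coe hw).symm
    refine OnePoint.continuous_coe.continuousAt.comp ?_
    fun_prop (disch := assumption)

theorem differentiableAt_affine_moebius {w : ℂ} (hw : moebius p₁ q₁ p₂ q₂ w ≠ OnePoint.infty) :
    DifferentiableAt ℂ (fun w => affine (moebius p₁ q₁ p₂ q₂ w)) w := by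
  have hq : q₁ + w * q₂ ≠ 0 := fun h => hw (pt_eq_infty.2 h)
  have h2 : DifferentiableAt ℂ (fun w => (p₁ + w * p₂) / (q₁ + w * q₂)) w := by
    fun_prop (disch := assumption)
  refine h2.congr_of_eventuallyEq ?_
  filter_upwards [moebius_eventuallyEq_coe hq] with x hx
  rw [hx, affine_coe]

/-- Numerator and denominator have no common zero, so near each `w` one of the two standard charts
presents the Möbius map as a holomorphic quotient. -/
theorem HolomorphicOn.comp_moebius {f : Sphere → ℂ} {D : Set Sphere} (hf : HolomorphicOn f D)
    (hD : IsOpen D) (h : p₁ * q₂ - p₂ * q₁ ≠ 0) {w : ℂ} (hw : moebius p₁ q₁ p₂ q₂ w ∈ D) :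
    DifferentiableAt ℂ (fun w => f (moebius p₁ q₁ p₂ q₂ w)) w := by
  by_cases hq : q₁ + w * q₂ = 0
  · have hp := moebius_num_ne_zero h hq
    have he := moebius_eventuallyEq_chartInfty (q₁ := q₁) (q₂ := q₂) hp
    rw [he.eq_of_nhds] at hw
    have h1 := hf.2.differentiableAt ((hD.preimage continuous_chartInfty).mem_nhds hw)
    have h2 : DifferentiableAt ℂ (fun w => (q₁ + w * q₂) / (p₁ + w * p₂)) w := by
      fun_prop (disch := assumption)
    have h3 : DifferentiableAt ℂ
        (fun w => f (chartInfty ((q₁ + w * q₂) / (p₁ + w * p₂)))) w := by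
      simpa only [Function.comp_def] using h1.comp w h2
    exact h3.congr_of_eventuallyEq (he.fun_comp f)
  · have he := moebius_eventuallyEq_coe (p₁ := p₁) (p₂ := p₂) hq
    rw [he.eq_of_nhds] at hw
    have h1 := hf.1.differentiableAt ((hD.preimage OnePoint.continuous_coe).mem_nhds hw)
    have h2 : DifferentiableAt ℂ (fun w => (p₁ + w * p₂) / (q₁ + w * q₂)) w := by
      fun_prop (disch := assumption)
    have h3 : DifferentiableAt ℂ
        (fun w => f (((p₁ + w * p₂) / (q₁ + w * q₂) : ℂ) : Sphere)) w := by
      simpa only [Function.comp_def] using h1.comp w h2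
    exact h3.congr_of_eventuallyEq (he.fun_comp f)

end Moebius

/-! ### Conformal representations -/

section Conformal

variable {D : Set Sphere} {a : Sphere} {χ : Sphere → ℂ}

theorem HolomorphicOn.continuousOn (h : HolomorphicOn χ D) (hD : IsOpen D) : ContinuousOn χ D := by
  intro x hx
  refine ContinuousAt.continuousWithinAt ?_
  rcases exists_chart x with ⟨z, rfl⟩ | ⟨w, rfl⟩
  · exact OnePoint.isOpenEmbedding_coe.continuousAt_iff.1
      (h.1.differentiableAt ((hD.preimage OnePoint.continuous_coe).mem_nhds hx)).continuousAt
  · exact isOpenEmbedding_chartInfty.continuousAt_iff.1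
      (h.2.differentiableAt ((hD.preimage continuous_chartInfty).mem_nhds hx)).continuousAt

theorem HolomorphicOn.isOpen_image (h : HolomorphicOn χ D) (hi : InjOn χ D) {V : Set Sphere}
    (hV : IsOpen V) (hVD : V ⊆ D) : IsOpen (χ '' V) := by
  have he : χ '' V = (fun z : ℂ => χ z) '' {z : ℂ | (z : Sphere) ∈ V} ∪
      (fun w : ℂ => χ (chartInfty w)) '' {w : ℂ | chartInfty w ∈ V} := by
    ext y
    constructor
    · rintro ⟨x, hx, rfl⟩
      rcases exists_chart x with ⟨z, rfl⟩ | ⟨w, rfl⟩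
      · exact Or.inl ⟨z, hx, rfl⟩
      · exact Or.inr ⟨w, hx, rfl⟩
    · rintro (⟨z, hz, rfl⟩ | ⟨z, hz, rfl⟩)
      · exact ⟨_, hz, rfl⟩
      · exact ⟨_, hz, rfl⟩
  rw [he]
  refine (isOpen_image_of_injOn (hV.preimage OnePoint.continuous_coe)
    (h.1.mono fun z hz => hVD hz) ?_).union (isOpen_image_of_injOn
      (hV.preimage continuous_chartInfty) (h.2.mono fun z hz => hVD hz) ?_)
  · exact fun x hx y hy hxy => OnePoint.coe_injective (hi (hVD hx) (hVD hy) hxy)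
  · exact fun x hx y hy hxy => chartInfty_injective (hi (hVD hx) (hVD hy) hxy)

/-- The inverse of a conformal representation. -/
def conformalInv (D : Set Sphere) (χ : Sphere → ℂ) : ℂ → Sphere := Function.invFunOn χ D

namespace IsConformalRepresentation

theorem inv_mem (h : IsConformalRepresentation D a χ) {w : ℂ} (hw : ‖w‖ < 1) :
    conformalInv D χ w ∈ D :=
  Function.invFunOn_mem (h.bijOn.surjOn (mem_ball_zero_iff.2 hw))

theorem apply_inv (h : IsConformalRepresentation D a χ) {w : ℂ} (hw : ‖w‖ < 1) :
    χ (conformalInv D χ w) = w :=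
  Function.invFunOn_eq (h.bijOn.surjOn (mem_ball_zero_iff.2 hw))

theorem inv_apply (h : IsConformalRepresentation D a χ) {x : Sphere} (hx : x ∈ D) :
    conformalInv D χ (χ x) = x :=
  h.bijOn.injOn.leftInvOn_invFunOn hx

theorem norm_lt_one (h : IsConformalRepresentation D a χ) {x : Sphere} (hx : x ∈ D) : ‖χ x‖ < 1 :=
  mem_ball_zero_iff.1 (h.bijOn.mapsTo hx)

theorem continuousOn_inv (h : IsConformalRepresentation D a χ) (hD : IsOpen D) :
    ContinuousOn (conformalInv D χ) {w | ‖w‖ < 1} := by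
  intro w hw
  refine ContinuousAt.continuousWithinAt fun V hV => ?_
  obtain ⟨W, hWV, hW, hwW⟩ := mem_nhds_iff.1 hV
  have h1 := h.holomorphicOn.isOpen_image h.bijOn.injOn (hW.inter hD) inter_subset_right
  refine mem_map.2 (mem_of_superset (h1.mem_nhds ⟨_, ⟨hwW, h.inv_mem hw⟩, h.apply_inv hw⟩) ?_)
  rintro _ ⟨x, ⟨hx, hxD⟩, rfl⟩
  rw [mem_preimage, h.inv_apply hxD]
  exact hWV hx

theorem injOn_inv (h : IsConformalRepresentation D a χ) :
    InjOn (conformalInv D χ) {w | ‖w‖ < 1} := fun x hx y hy hxy => by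
  rw [← h.apply_inv hx, ← h.apply_inv hy, hxy]

theorem differentiableAt_affine_inv (h : IsConformalRepresentation D a χ) (hD : IsOpen D) {w : ℂ}
    (hw : ‖w‖ < 1) (hne : conformalInv D χ w ≠ OnePoint.infty) :
    DifferentiableAt ℂ (fun w => affine (conformalInv D χ w)) w := by
  have hz : ((affine (conformalInv D χ w) : ℂ) : Sphere) ∈ D := by
    rw [coe_affine hne]; exact h.inv_mem hw
  have := differentiableAt_of_leftInverse (hD.preimage OnePoint.continuous_coe)
    h.holomorphicOn.1 (g := fun w => affine (conformalInv D χ w))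
    (fun z hz => by rw [h.inv_apply hz, affine_coe]) hz
  rwa [coe_affine hne, h.apply_inv hw] at this

theorem isClosed_image_inv (h : IsConformalRepresentation D a χ) (hD : IsOpen D) {K : Set ℂ}
    (hK : IsCompact K) (hK1 : ∀ w ∈ K, ‖w‖ < 1) : IsClosed (conformalInv D χ '' K) :=
  (hK.image_of_continuousOn ((h.continuousOn_inv hD).mono hK1)).isClosed

theorem image_inv (h : IsConformalRepresentation D a χ) {K : Set ℂ} (hK1 : ∀ w ∈ K, ‖w‖ < 1) :
    conformalInv D χ '' K = {x ∈ D | χ x ∈ K} := by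
  ext x
  constructor
  · rintro ⟨w, hw, rfl⟩
    exact ⟨h.inv_mem (hK1 w hw), by rwa [h.apply_inv (hK1 w hw)]⟩
  · rintro ⟨hx, hxK⟩
    exact ⟨_, hxK, h.inv_apply hx⟩

theorem isConnected_norm_mem (h : IsConformalRepresentation D a χ) (hD : IsOpen D) {I : Set ℝ}
    (hI : IsConnected I) (h0 : ∀ t ∈ I, 0 ≤ t ∧ t < 1) : IsConnected {x ∈ D | ‖χ x‖ ∈ I} := by
  have h1 : ∀ w ∈ {z : ℂ | ‖z‖ ∈ I}, ‖w‖ < 1 := fun w hw => (h0 _ hw).2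
  have := (MarkedDisc.isConnected_norm_mem hI fun t ht => (h0 t ht).1).image _
    ((h.continuousOn_inv hD).mono h1)
  rwa [h.image_inv h1] at this

theorem isClosed_norm_mem (h : IsConformalRepresentation D a χ) (hD : IsOpen D) {I : Set ℝ}
    (hI : IsClosed I) {b : ℝ} (hb : b < 1) (h0 : ∀ t ∈ I, t ≤ b) :
    IsClosed {x ∈ D | ‖χ x‖ ∈ I} := by
  have h1 : ∀ w ∈ {z : ℂ | ‖z‖ ∈ I}, ‖w‖ < 1 := fun w hw => (h0 _ hw).trans_lt hb
  have hK : IsCompact {z : ℂ | ‖z‖ ∈ I} :=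
    Metric.isCompact_of_isClosed_isBounded (hI.preimage continuous_norm)
      ((Metric.isBounded_closedBall (x := (0 : ℂ)) (r := b)).subset fun z hz => by
        simpa using h0 _ hz)
  have := h.isClosed_image_inv hD hK h1
  rwa [h.image_inv h1] at this

theorem isOpen_norm_mem (h : IsConformalRepresentation D a χ) (hD : IsOpen D) {I : Set ℝ}
    (hI : IsOpen I) : IsOpen {x ∈ D | ‖χ x‖ ∈ I} :=
  (h.holomorphicOn.continuousOn hD).norm.isOpen_inter_preimage hD hI

end IsConformalRepresentation

end Conformal

/-! ### Annuli cut out by equipotentials -/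

/-- The closed disc bounded by an equipotential. -/
def core (D : Set Sphere) (χ : Sphere → ℂ) (r : ℝ) : Set Sphere := {x ∈ D | ‖χ x‖ ∈ Iic r}

/-- The annulus between an equipotential and the boundary of the disc. -/
def collar (D : Set Sphere) (χ : Sphere → ℂ) (r : ℝ) : Set Sphere := {x ∈ D | ‖χ x‖ ∈ Ioi r}

theorem core_subset {D : Set Sphere} {χ : Sphere → ℂ} {r : ℝ} : core D χ r ⊆ D := fun _ h => h.1

theorem compl_collar (D : Set Sphere) (χ : Sphere → ℂ) (r : ℝ) :
    (collar D χ r)ᶜ = core D χ r ∪ Dᶜ := by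
  ext x
  simp only [collar, core, mem_compl_iff, mem_ofPred_eq, mem_union, mem_Ioi, mem_Iic, not_and,
    not_lt]
  tauto

theorem core_union_collar (D : Set Sphere) (χ : Sphere → ℂ) (r : ℝ) :
    core D χ r ∪ collar D χ r = D := by
  ext x
  simp only [collar, core, mem_union, mem_ofPred_eq, mem_Ioi, mem_Iic]
  constructor
  · rintro (h | h) <;> exact h.1
  · exact fun h => (le_or_gt (‖χ x‖) r).imp (fun h' => ⟨h, h'⟩) fun h' => ⟨h, h'⟩

namespace IsConformalRepresentation

variable {D : Set Sphere} {a : Sphere} {χ : Sphere → ℂ}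

theorem isClosed_core (h : IsConformalRepresentation D a χ) (hD : IsOpen D) {r : ℝ}
    (hr1 : r < 1) : IsClosed (core D χ r) :=
  h.isClosed_norm_mem hD isClosed_Iic hr1 fun _ ht => ht

theorem isConnected_core (h : IsConformalRepresentation D a χ) (hD : IsOpen D) {r : ℝ}
    (hr : 0 ≤ r) (hr1 : r < 1) : IsConnected (core D χ r) := by
  have := h.isConnected_norm_mem hD (isConnected_Icc hr)
    fun t ht => ⟨ht.1, ht.2.trans_lt hr1⟩
  simpa [core] using this

theorem isConnected_collar (h : IsConformalRepresentation D a χ) (hD : IsOpen D) {r : ℝ}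
    (hr : 0 ≤ r) (hr1 : r < 1) : IsConnected (collar D χ r) := by
  have := h.isConnected_norm_mem hD (isConnected_Ioo hr1)
    fun t ht => ⟨hr.trans ht.1.le, ht.2⟩
  convert this using 1
  ext x
  exact ⟨fun hx => ⟨hx.1, hx.2, h.norm_lt_one hx.1⟩, fun hx => ⟨hx.1, hx.2.1⟩⟩

theorem isOpen_collar (h : IsConformalRepresentation D a χ) (hD : IsOpen D) {r : ℝ} :
    IsOpen (collar D χ r) :=
  h.isOpen_norm_mem hD isOpen_Ioi

/-- Compactness of the sphere. This replaces any knowledge of the boundary behaviour of `χ`: the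
complement of a neighbourhood of `Dᶜ` stays in some `|χ| ≤ b < 1`. -/
theorem exists_norm_le (h : IsConformalRepresentation D a χ) (hD : IsOpen D) {K : Set Sphere}
    (hK : IsClosed K) (hKD : K ⊆ D) : ∃ b, 0 ≤ b ∧ b < 1 ∧ ∀ x ∈ K, ‖χ x‖ ≤ b := by
  rcases K.eq_empty_or_nonempty with rfl | hne
  · exact ⟨0, le_rfl, zero_lt_one, by simp⟩
  · obtain ⟨x, hx, hmax⟩ := hK.isCompact.exists_isMaxOn hne
      ((h.holomorphicOn.continuousOn hD).norm.mono hKD)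
    exact ⟨‖χ x‖, norm_nonneg _, h.norm_lt_one (hKD hx), fun y hy => hmax hy⟩

/-- Off `U`, the open set `V` contains only points of `Q` and of the core. Hence `Q = V \ core` is
open as well as closed, and the sphere is connected. -/
theorem eq_empty_of_collar_subset (h : IsConformalRepresentation D a χ) (hD : IsOpen D)
    {P Q U V : Set Sphere} (hQ : IsClosed Q) (hPQ : Dᶜ = P ∪ Q) (hPU : P ⊆ U) (hQV : Q ⊆ V)
    (hV : IsOpen V) (hUV : Disjoint U V) {b : ℝ} (hb1 : b < 1) (hcol : collar D χ b ⊆ U)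
    (hP : P.Nonempty) : Q = ∅ := by
  have hQD : Q = V \ core D χ b := by
    ext x
    constructor
    · exact fun hx => ⟨hQV hx, fun hx' => (hPQ.symm.subset (Or.inr hx)) hx'.1⟩
    · rintro ⟨hxV, hxc⟩
      have hxU := Set.disjoint_right.1 hUV hxV
      have h1 : x ∈ (collar D χ b)ᶜ := fun hx => hxU (hcol hx)
      rw [compl_collar, hPQ] at h1
      exact (h1.resolve_left hxc).resolve_left fun hx => hxU (hPU hx)
  have hcl : IsClopen Q := ⟨hQ, hQD ▸ hV.sdiff (h.isClosed_core hD hb1)⟩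
  refine (isClopen_iff.1 hcl).resolve_right fun hu => ?_
  obtain ⟨x, hx⟩ := hP
  exact Set.disjoint_left.1 hUV (hPU hx) (hQV (hu ▸ mem_univ x))

/-- If `Dᶜ` split into two closed parts with disjoint neighbourhoods `U` and `V`, a thin collar
would lie in `U ∪ V`. Being connected, it would lie in one of them, which makes the part in the
other one clopen in the sphere. -/
theorem isConnected_compl (h : IsConformalRepresentation D a χ) (hD : IsOpen D)
    (hne : Dᶜ.Nonempty) : IsConnected Dᶜ := by
  refine ⟨hne, isPreconnected_iff_subset_of_disjoint_closed.2 fun u v hu hv hsub hdis => ?_⟩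
  have hP : IsClosed (Dᶜ ∩ u) := hD.isClosed_compl.inter hu
  have hQ : IsClosed (Dᶜ ∩ v) := hD.isClosed_compl.inter hv
  have hPQ : Dᶜ = (Dᶜ ∩ u) ∪ (Dᶜ ∩ v) := by
    rw [← inter_union_distrib_left, inter_eq_left.2 hsub]
  have hd : Disjoint (Dᶜ ∩ u) (Dᶜ ∩ v) := by
    rw [Set.disjoint_iff_inter_eq_empty, ← inter_inter_distrib_left, hdis]
  obtain ⟨U, V, hU, hV, hPU, hQV, hUV⟩ := SeparatedNhds.of_isCompact_isCompact hP.isCompact hQ.isCompact hd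
  obtain ⟨b, hb0, hb1, hb⟩ := h.exists_norm_le hD (hU.union hV).isClosed_compl (by
    intro x hx
    by_contra hxD
    exact hx ((hPQ.subset hxD).imp (fun h => hPU h) fun h => hQV h))
  have hcol : collar D χ b ⊆ U ∪ V := by
    intro x hx
    by_contra hxU
    exact absurd hx.2 (not_lt.2 (hb x hxU))
  by_contra! hcon
  have hPne : (Dᶜ ∩ u).Nonempty := by
    obtain ⟨x, hx, hxv⟩ := not_subset.1 hcon.2
    exact ⟨x, hx, (hsub hx).resolve_right hxv⟩
  have hQne : (Dᶜ ∩ v).Nonempty := by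
    obtain ⟨x, hx, hxu⟩ := not_subset.1 hcon.1
    exact ⟨x, hx, (hsub hx).resolve_left hxu⟩
  rcases isPreconnected_iff_subset_of_disjoint.1 (h.isConnected_collar hD hb0 hb1).isPreconnected
    U V hU hV hcol (by rw [hUV.inter_eq, inter_empty]) with hc | hc
  · exact hQne.ne_empty (h.eq_empty_of_collar_subset hD hQ hPQ hPU hQV hV hUV hb1 hc hPne)
  · exact hPne.ne_empty (h.eq_empty_of_collar_subset hD hP (hPQ.trans (union_comm _ _)) hQV hPU hU
      hUV.symm hb1 hc hQne)

theorem isAnnulus_collar (h : IsConformalRepresentation D a χ) (hD : IsOpen D)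
    (hne : Dᶜ.Nonempty) {r : ℝ} (hr : 0 ≤ r) (hr1 : r < 1) :
    IsAnnulus (collar D χ r) (core D χ r) Dᶜ where
  isConnected := h.isConnected_collar hD hr hr1
  isClosed_left := h.isClosed_core hD hr1
  isClosed_right := hD.isClosed_compl
  isConnected_left := h.isConnected_core hD hr hr1
  isConnected_right := h.isConnected_compl hD hne
  disjoint := Set.disjoint_compl_right_iff_subset.2 core_subset
  compl_eq := compl_collar D χ r

theorem exists_mem_closure_collar (h : IsConformalRepresentation D a χ) (hD : IsOpen D) {r : ℝ}
    (hr : 0 ≤ r) (hr1 : r < 1) : (closure (collar D χ r) ∩ {x ∈ D | ‖χ x‖ = r}).Nonempty := by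
  have hn : ‖(r : ℂ)‖ = r := by simp [abs_of_nonneg hr]
  have hc : ContinuousWithinAt (fun t : ℝ => conformalInv D χ t) (Ioo r 1) r := by
    refine ContinuousAt.continuousWithinAt ?_
    have h1 : ContinuousAt (conformalInv D χ) (r : ℂ) :=
      (h.continuousOn_inv hD).continuousAt
        ((isOpen_lt continuous_norm continuous_const).mem_nhds (show ‖(r : ℂ)‖ < 1 by rwa [hn]))
    exact ContinuousAt.comp h1 Complex.continuous_ofReal.continuousAt
  have h2 := hc.mem_closure_image (by rw [closure_Ioo hr1.ne]; exact ⟨le_rfl, hr1.le⟩)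
  have hr1' : ‖(r : ℂ)‖ < 1 := by rwa [hn]
  refine ⟨_, closure_mono ?_ h2, h.inv_mem hr1', by rw [h.apply_inv hr1', hn]⟩
  rintro _ ⟨t, ht, rfl⟩
  have htn : ‖(t : ℂ)‖ = t := by simp [abs_of_nonneg (hr.trans ht.1.le)]
  have ht1 : ‖(t : ℂ)‖ < 1 := by rw [htn]; exact ht.2
  exact ⟨h.inv_mem ht1, by rw [h.apply_inv ht1, htn]; exact ht.1⟩

end IsConformalRepresentation

/-- The condition `hout` confines the component of any point outside `A` to a set whose closure
misses `K` or `L`, so only `A` is adherent to both. -/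
theorem annulusBetween_eq {K L A : Set Sphere} (hA : IsConnected A) (hsub : A ⊆ (K ∪ L)ᶜ)
    (hK : (closure A ∩ K).Nonempty) (hL : (closure A ∩ L).Nonempty)
    (hout : ∀ x ∈ (K ∪ L)ᶜ, x ∉ A → ∃ U V : Set Sphere, IsOpen U ∧ IsOpen V ∧ Disjoint U V ∧
      (K ∪ L)ᶜ ⊆ U ∪ V ∧ x ∈ U ∧ (Disjoint (closure U) K ∨ Disjoint (closure U) L)) :
    annulusBetween K L = A := by
  ext x
  constructor
  · rintro ⟨hx, h1, h2⟩
    by_contra hxA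
    obtain ⟨U, V, hU, hV, hUV, hc, hxU, hor⟩ := hout x hx hxA
    have hsubU : connectedComponentIn (K ∪ L)ᶜ x ⊆ U :=
      isPreconnected_connectedComponentIn.subset_left_of_subset_union hU hV hUV
        ((connectedComponentIn_subset _ _).trans hc) ⟨x, mem_connectedComponentIn hx, hxU⟩
    rcases hor with h | h
    · obtain ⟨y, hy, hyK⟩ := h1
      exact Set.disjoint_left.1 h (closure_mono hsubU hy) hyK
    · obtain ⟨y, hy, hyK⟩ := h2
      exact Set.disjoint_left.1 h (closure_mono hsubU hy) hyK
  · intro hx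
    have := closure_mono (hA.isPreconnected.subset_connectedComponentIn hx hsub)
    exact ⟨hsub hx, hK.mono (inter_subset_inter_left _ this),
      hL.mono (inter_subset_inter_left _ this)⟩

namespace IsConformalRepresentation

theorem disc_separation {D : Set Sphere} {a : Sphere} {χ : Sphere → ℂ}
    (h : IsConformalRepresentation D a χ) (hD : IsOpen D) {r : ℝ} (hr1 : r < 1) {C : Set Sphere}
    (hC : Disjoint C {x ∈ D | ‖χ x‖ = r}) {x : Sphere} (hx : x ∈ core D χ r) (hxC : x ∈ C) :
    ∃ U V : Set Sphere, IsOpen U ∧ IsOpen V ∧ Disjoint U V ∧ C ⊆ U ∪ V ∧ x ∈ U ∧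
      closure U ⊆ core D χ r := by
  have key : ∀ y ∈ core D χ r, y ∈ C → y ∈ {x ∈ D | ‖χ x‖ ∈ Iio r} := fun y hy hyC =>
    ⟨hy.1, lt_of_le_of_ne hy.2 fun he => Set.disjoint_left.1 hC hyC ⟨hy.1, he⟩⟩
  have hsub : {x ∈ D | ‖χ x‖ ∈ Iio r} ⊆ core D χ r := fun y hy => ⟨hy.1, (mem_Iio.1 hy.2).le⟩
  refine ⟨_, _, h.isOpen_norm_mem hD isOpen_Iio, (h.isClosed_core hD hr1).isOpen_compl,
    Set.disjoint_compl_right_iff_subset.2 hsub, fun y hy => ?_, key x hx hxC,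
    closure_minimal hsub (h.isClosed_core hD hr1)⟩
  by_cases hyc : y ∈ core D χ r
  · exact Or.inl (key y hyc hy)
  · exact Or.inr hyc

theorem annulusBetween_frontier {D : Set Sphere} {a : Sphere} {χ : Sphere → ℂ}
    (h : IsConformalRepresentation D a χ) (hD : IsOpen D) (hne : Dᶜ.Nonempty) {r : ℝ} (hr : 0 ≤ r)
    (hr1 : r < 1) : annulusBetween (frontier D) {x ∈ D | ‖χ x‖ = r} = collar D χ r := by
  have hfr : Disjoint D (frontier D) := by
    rw [hD.frontier_eq]; exact disjoint_sdiff_right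
  refine annulusBetween_eq (h.isConnected_collar hD hr hr1) ?_ ?_
    (h.exists_mem_closure_collar hD hr hr1) ?_
  · rintro x hx (hx' | hx')
    · exact Set.disjoint_left.1 hfr hx.1 hx'
    · exact absurd hx'.2 (ne_of_gt hx.2)
  · have hDne : D.Nonempty := (h.isConnected_core hD hr hr1).nonempty.mono core_subset
    obtain ⟨x, hx⟩ : (frontier D).Nonempty :=
      nonempty_frontier_iff.2 ⟨hDne, fun hu => by simp [hu] at hne⟩
    have h1 := frontier_subset_closure hx
    rw [← core_union_collar D χ r, closure_union, (h.isClosed_core hD hr1).closure_eq] at h1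
    exact ⟨x, h1.resolve_left fun h2 => Set.disjoint_left.1 hfr h2.1 hx, hx⟩
  · intro x hx hxA
    -- Points inside the equipotential are cut off by `|χ| < r`, whose closure stays in `D` and
    -- misses the frontier. Points outside `D` lie in the exterior of `D`, whose closure misses the
    -- equipotential.
    by_cases hxD : x ∈ D
    · obtain ⟨U, V, hU, hV, hUV, hc, hxU, hcl⟩ := h.disc_separation hD hr1
        (C := (frontier D ∪ {x ∈ D | ‖χ x‖ = r})ᶜ)
        (disjoint_compl_left.mono_right subset_union_right)
        (((core_union_collar D χ r).symm.subset hxD).resolve_right hxA) hx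
      exact ⟨U, V, hU, hV, hUV, hc, hxU, Or.inl (hfr.mono_left (hcl.trans core_subset))⟩
    · refine ⟨(closure D)ᶜ, D, isClosed_closure.isOpen_compl, hD,
        Set.disjoint_compl_left_iff_subset.2 subset_closure, ?_, ?_, Or.inr ?_⟩
      · intro y hy
        by_cases hyD : y ∈ D
        · exact Or.inr hyD
        · refine Or.inl fun hyc => hy (Or.inl ?_)
          rw [hD.frontier_eq]; exact ⟨hyc, hyD⟩
      · refine fun hyc => hx (Or.inl ?_)
        rw [hD.frontier_eq]; exact ⟨hyc, hxD⟩
      · have : closure (closure D)ᶜ ⊆ Dᶜ :=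
          closure_minimal (compl_subset_compl.2 subset_closure) hD.isClosed_compl
        exact (Set.disjoint_compl_left_iff_subset.2 fun x hx => hx.1).mono_left this

/-! ### The annulus between equipotentials of two disjoint discs -/

section TwoDiscs

variable {D₁ D₂ : Set Sphere} {a₁ a₂ : Sphere} {χ₁ χ₂ : Sphere → ℂ}

/-- In a splitting `P ∪ Q` each collar lies on one side. If both lie in `P`, then `Q` has the open
complement `P ∪ D₁ ∪ D₂`, so it is clopen and empty. If they lie on different sides, `P ∪ D₁` and `Q
∪ D₂` would partition the sphere into two nonempty open sets. -/
theorem isConnected_compl_cores (h₁ : IsConformalRepresentation D₁ a₁ χ₁)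
    (h₂ : IsConformalRepresentation D₂ a₂ χ₂) (hD₁ : IsOpen D₁) (hD₂ : IsOpen D₂)
    (hD : Disjoint D₁ D₂) {r₁ r₂ : ℝ} (hr₁ : 0 ≤ r₁) (hr₁' : r₁ < 1) (hr₂ : 0 ≤ r₂)
    (hr₂' : r₂ < 1) : IsConnected (core D₁ χ₁ r₁ ∪ core D₂ χ₂ r₂)ᶜ := by
  have hE := h₁.isClosed_core hD₁ hr₁'
  have hF := h₂.isClosed_core hD₂ hr₂'
  have hA : IsOpen (core D₁ χ₁ r₁ ∪ core D₂ χ₂ r₂)ᶜ := (hE.union hF).isOpen_compl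
  have hc₁ : collar D₁ χ₁ r₁ ⊆ (core D₁ χ₁ r₁ ∪ core D₂ χ₂ r₂)ᶜ := by
    rintro x hx (hx' | hx')
    · exact absurd (mem_Ioi.1 hx.2) (not_lt.2 hx'.2)
    · exact Set.disjoint_left.1 hD hx.1 hx'.1
  have hc₂ : collar D₂ χ₂ r₂ ⊆ (core D₁ χ₁ r₁ ∪ core D₂ χ₂ r₂)ᶜ := by
    rintro x hx (hx' | hx')
    · exact Set.disjoint_left.1 hD hx'.1 hx.1
    · exact absurd (mem_Ioi.1 hx.2) (not_lt.2 hx'.2)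
  have hC₁ := h₁.isConnected_collar hD₁ hr₁ hr₁'
  have hC₂ := h₂.isConnected_collar hD₂ hr₂ hr₂'
  -- a relatively clopen part that misses both collars is empty
  have same : ∀ P Q : Set Sphere, IsOpen P → IsOpen Q → Disjoint P Q →
      (core D₁ χ₁ r₁ ∪ core D₂ χ₂ r₂)ᶜ = P ∪ Q → collar D₁ χ₁ r₁ ⊆ P →
      (core D₁ χ₁ r₁ ∪ core D₂ χ₂ r₂)ᶜ ⊆ P := by
    intro P Q hP hQ hPQ hun hcP
    rcases hC₂.isPreconnected.subset_or_subset hP hQ hPQ (hun ▸ hc₂) with h | h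
    · have hQe : Qᶜ = P ∪ D₁ ∪ D₂ := by
        rw [← core_union_collar D₁ χ₁ r₁, ← core_union_collar D₂ χ₂ r₂]
        ext x
        have h1 : x ∈ (core D₁ χ₁ r₁ ∪ core D₂ χ₂ r₂)ᶜ ↔ x ∈ P ∪ Q := by rw [hun]
        have h2 : x ∈ P → x ∉ Q := fun a b => Set.disjoint_left.1 hPQ a b
        have h3 := @hcP x
        have h4 := @h x
        simp only [mem_compl_iff, mem_union] at h1 ⊢
        tauto
      have hcl : IsClopen Q := ⟨⟨hQe ▸ (hP.union hD₁).union hD₂⟩, hQ⟩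
      have h0 := (isClopen_iff.1 hcl).resolve_right fun hu => by
        obtain ⟨x, hx⟩ := hC₁.nonempty
        exact Set.disjoint_left.1 hPQ (hcP hx) (hu ▸ mem_univ x)
      rw [hun, h0, union_empty]
    · exfalso
      have hQe : (P ∪ D₁)ᶜ = Q ∪ D₂ := by
        rw [← core_union_collar D₁ χ₁ r₁, ← core_union_collar D₂ χ₂ r₂]
        ext x
        have h1 : x ∈ (core D₁ χ₁ r₁ ∪ core D₂ χ₂ r₂)ᶜ ↔ x ∈ P ∪ Q := by rw [hun]
        have h2 : x ∈ P → x ∉ Q := fun a b => Set.disjoint_left.1 hPQ a b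
        have h3 := @hcP x
        have h4 := @h x
        have h5 : x ∈ core D₁ χ₁ r₁ → x ∉ core D₂ χ₂ r₂ := fun a b =>
          Set.disjoint_left.1 hD a.1 b.1
        simp only [mem_compl_iff, mem_union] at h1 ⊢
        tauto
      have hcl : IsClopen (P ∪ D₁) := ⟨⟨hQe ▸ hQ.union hD₂⟩, hP.union hD₁⟩
      rcases isClopen_iff.1 hcl with h0 | h0
      · obtain ⟨x, hx⟩ := hC₁.nonempty
        exact (h0 ▸ (Or.inr hx.1 : x ∈ P ∪ D₁) : x ∈ (∅ : Set Sphere))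
      · obtain ⟨x, hx⟩ := hC₂.nonempty
        have : x ∈ (P ∪ D₁)ᶜ := hQe ▸ Or.inr hx.1
        exact this (h0 ▸ mem_univ x)
  refine ⟨hC₁.nonempty.mono hc₁, isPreconnected_iff_subset_of_disjoint.2 fun U V hU hV hs hd => ?_⟩
  set A := (core D₁ χ₁ r₁ ∪ core D₂ χ₂ r₂)ᶜ with hAdef
  have hd' : Disjoint (A ∩ U) (A ∩ V) := by
    rw [Set.disjoint_iff_inter_eq_empty, ← inter_inter_distrib_left, hd]
  have hun : A = A ∩ U ∪ A ∩ V := by rw [← inter_union_distrib_left, inter_eq_left.2 hs]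
  rcases hC₁.isPreconnected.subset_or_subset (hA.inter hU) (hA.inter hV) hd' (hun ▸ hc₁) with h | h
  · exact Or.inl ((same _ _ (hA.inter hU) (hA.inter hV) hd' hun h).trans inter_subset_right)
  · exact Or.inr ((same _ _ (hA.inter hV) (hA.inter hU) hd'.symm (hun.trans (union_comm _ _))
      h).trans inter_subset_right)

theorem isAnnulus_compl_cores (h₁ : IsConformalRepresentation D₁ a₁ χ₁)
    (h₂ : IsConformalRepresentation D₂ a₂ χ₂) (hD₁ : IsOpen D₁) (hD₂ : IsOpen D₂)
    (hD : Disjoint D₁ D₂) {r₁ r₂ : ℝ} (hr₁ : 0 ≤ r₁) (hr₁' : r₁ < 1) (hr₂ : 0 ≤ r₂)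
    (hr₂' : r₂ < 1) : IsAnnulus (core D₁ χ₁ r₁ ∪ core D₂ χ₂ r₂)ᶜ (core D₁ χ₁ r₁)
      (core D₂ χ₂ r₂) where
  isConnected := h₁.isConnected_compl_cores h₂ hD₁ hD₂ hD hr₁ hr₁' hr₂ hr₂'
  isClosed_left := h₁.isClosed_core hD₁ hr₁'
  isClosed_right := h₂.isClosed_core hD₂ hr₂'
  isConnected_left := h₁.isConnected_core hD₁ hr₁ hr₁'
  isConnected_right := h₂.isConnected_core hD₂ hr₂ hr₂'
  disjoint := hD.mono core_subset core_subset
  compl_eq := compl_compl _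

theorem annulusBetween_equipotentials (h₁ : IsConformalRepresentation D₁ a₁ χ₁)
    (h₂ : IsConformalRepresentation D₂ a₂ χ₂) (hD₁ : IsOpen D₁) (hD₂ : IsOpen D₂)
    (hD : Disjoint D₁ D₂) {r₁ r₂ : ℝ} (hr₁ : 0 ≤ r₁) (hr₁' : r₁ < 1) (hr₂ : 0 ≤ r₂)
    (hr₂' : r₂ < 1) :
    annulusBetween {x ∈ D₁ | ‖χ₁ x‖ = r₁} {x ∈ D₂ | ‖χ₂ x‖ = r₂} =
      (core D₁ χ₁ r₁ ∪ core D₂ χ₂ r₂)ᶜ := by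
  have hs₁ : {x ∈ D₁ | ‖χ₁ x‖ = r₁} ⊆ core D₁ χ₁ r₁ := fun x hx => ⟨hx.1, hx.2.le⟩
  have hs₂ : {x ∈ D₂ | ‖χ₂ x‖ = r₂} ⊆ core D₂ χ₂ r₂ := fun x hx => ⟨hx.1, hx.2.le⟩
  refine annulusBetween_eq (h₁.isConnected_compl_cores h₂ hD₁ hD₂ hD hr₁ hr₁' hr₂ hr₂')
    (compl_subset_compl.2 (union_subset_union hs₁ hs₂))
    ((h₁.exists_mem_closure_collar hD₁ hr₁ hr₁').mono
      (inter_subset_inter_left _ (closure_mono ?_)))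
    ((h₂.exists_mem_closure_collar hD₂ hr₂ hr₂').mono
      (inter_subset_inter_left _ (closure_mono ?_))) ?_
  · rintro x hx (hx' | hx')
    · exact absurd (mem_Ioi.1 hx.2) (not_lt.2 hx'.2)
    · exact Set.disjoint_left.1 hD hx.1 hx'.1
  · rintro x hx (hx' | hx')
    · exact Set.disjoint_left.1 hD hx'.1 hx.1
    · exact absurd (mem_Ioi.1 hx.2) (not_lt.2 hx'.2)
  · intro x hx hxA
    rcases not_not.1 hxA with hxc | hxc
    · obtain ⟨U, V, hU, hV, hUV, hc, hxU, hcl⟩ := h₁.disc_separation hD₁ hr₁'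
        (disjoint_compl_left.mono_right subset_union_left) hxc hx
      exact ⟨U, V, hU, hV, hUV, hc, hxU,
        Or.inr (hD.mono (hcl.trans core_subset) fun x hx => hx.1)⟩
    · obtain ⟨U, V, hU, hV, hUV, hc, hxU, hcl⟩ := h₂.disc_separation hD₂ hr₂'
        (disjoint_compl_left.mono_right subset_union_right) hxc hx
      exact ⟨U, V, hU, hV, hUV, hc, hxU,
        Or.inl (hD.symm.mono (hcl.trans core_subset) fun x hx => hx.1)⟩

end TwoDiscs

end IsConformalRepresentation

/-- An admissible function comes with its own labelled pair of complementary components. This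
identifies that pair with the given one up to order. -/
theorem IsAnnulus.unique {A E F E' F' : Set Sphere} (h : IsAnnulus A E F)
    (h' : IsAnnulus A E' F') : (E' = E ∧ F' = F) ∨ (E' = F ∧ F' = E) := by
  have hun := h.compl_eq.symm.trans h'.compl_eq
  have hdis : ∀ s : Set Sphere, IsConnected s → s ⊆ E ∪ F → s ⊆ E ∨ s ⊆ F := fun s hs h1 =>
    isPreconnected_iff_subset_of_disjoint_closed.1 hs.isPreconnected E F h.isClosed_left
      h.isClosed_right h1 (by rw [h.disjoint.inter_eq, Set.inter_empty])
  obtain ⟨e, he⟩ := h.isConnected_left.nonempty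
  obtain ⟨f, hf⟩ := h.isConnected_right.nonempty
  have hd : ∀ x, x ∈ E → x ∉ F := fun x a b => Set.disjoint_left.1 h.disjoint a b
  have hd' : ∀ x, x ∈ E' → x ∉ F' := fun x a b => Set.disjoint_left.1 h'.disjoint a b
  have hx : ∀ x, (x ∈ E ∨ x ∈ F) ↔ (x ∈ E' ∨ x ∈ F') := fun x => by
    rw [← mem_union, ← mem_union, hun]
  rcases hdis E' h'.isConnected_left (hun ▸ subset_union_left) with h1 | h1 <;>
    rcases hdis F' h'.isConnected_right (hun ▸ subset_union_right) with h2 | h2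
  · exact absurd hf (hd f (((hx f).1 (Or.inr hf)).elim (fun a => h1 a) fun a => h2 a))
  · refine Or.inl ⟨h1.antisymm fun x hxE => ?_, h2.antisymm fun x hxF => ?_⟩
    · exact ((hx x).1 (Or.inl hxE)).resolve_right fun a => hd x hxE (h2 a)
    · exact ((hx x).1 (Or.inr hxF)).resolve_left fun a => hd x (h1 a) hxF
  · refine Or.inr ⟨h1.antisymm fun x hxF => ?_, h2.antisymm fun x hxE => ?_⟩
    · exact ((hx x).1 (Or.inr hxF)).resolve_right fun a => hd x (h2 a) hxF
    · exact ((hx x).1 (Or.inl hxE)).resolve_left fun a => hd x hxE (h1 a)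
  · exact absurd (((hx e).1 (Or.inl he)).elim (fun a => h1 a) fun a => h2 a) (hd e he)

/-! ### The length-area estimate -/

theorem det_restrictScalars_toSpanSingleton (c : ℂ) :
    ((ContinuousLinearMap.toSpanSingleton ℂ c).restrictScalars ℝ).det = ‖c‖ ^ 2 := by
  simp [ContinuousLinearMap.det, LinearMap.det_restrictScalars, Algebra.norm_complex_apply,
    Complex.normSq_eq_norm_sq]

/-- The real Jacobian of `g` is `|g'|²`, the square of the factor by which composition with `g`
scales gradients. This is the conformal invariance of the Dirichlet integral. -/
theorem lintegral_image_holomorphic {s : Set ℂ} (hs : MeasurableSet s) {g : ℂ → ℂ}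
    (hd : ∀ w ∈ s, DifferentiableAt ℂ g w) (hi : InjOn g s) (F : ℂ → ℝ≥0∞) :
    ∫⁻ z in g '' s, F z = ∫⁻ w in s, ‖deriv g w‖ₑ ^ 2 * F (g w) := by
  rw [lintegral_image_eq_lintegral_abs_det_fderiv_mul volume hs
    (f' := fun w => (ContinuousLinearMap.toSpanSingleton ℂ (deriv g w)).restrictScalars ℝ)
    (fun w hw => ((hd w hw).hasDerivAt.hasFDerivAt.restrictScalars ℝ).hasFDerivWithinAt) hi]
  refine lintegral_congr fun w => ?_
  rw [det_restrictScalars_toSpanSingleton, abs_of_nonneg (by positivity),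
    ENNReal.ofReal_pow (norm_nonneg _), ofReal_norm]

/-- Here `t` is the first time the level `β` is reached, and `s` is the last time before `t` at
which the value is at most `α`. Admissible functions are differentiable only inside the annulus, and
strict intermediate values guarantee being there. -/
theorem exists_crossing {f : ℝ → ℝ} {a b α β : ℝ} (hab : a ≤ b) (hf : ContinuousOn f (Icc a b))
    (hαβ : α < β) (ha : f a ≤ α) (hb : β ≤ f b) :
    ∃ s t, a ≤ s ∧ s < t ∧ t ≤ b ∧ f s ≤ α ∧ β ≤ f t ∧ ∀ x ∈ Ioo s t, α < f x ∧ f x < β := by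
  have hS : IsCompact {x ∈ Icc a b | f x ∈ Ici β} :=
    isCompact_Icc.of_isClosed_subset (hf.preimage_isClosed_of_isClosed isClosed_Icc isClosed_Ici)
      fun x hx => hx.1
  obtain ⟨t, ht, htmin⟩ := hS.exists_isLeast ⟨b, ⟨hab, le_rfl⟩, hb⟩
  have hft : ContinuousOn f (Icc a t) := hf.mono (Icc_subset_Icc_right ht.1.2)
  have hT : IsCompact {x ∈ Icc a t | f x ∈ Iic α} :=
    isCompact_Icc.of_isClosed_subset (hft.preimage_isClosed_of_isClosed isClosed_Icc isClosed_Iic)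
      fun x hx => hx.1
  obtain ⟨s, hs, hsmax⟩ := hT.exists_isGreatest ⟨a, ⟨le_rfl, ht.1.1⟩, ha⟩
  have hfs : f s ≤ α := hs.2
  have hft : β ≤ f t := ht.2
  refine ⟨s, t, hs.1.1, lt_of_le_of_ne hs.1.2 ?_, ht.1.2, hfs, hft, fun x hx => ⟨?_, ?_⟩⟩
  · rintro rfl
    linarith
  · by_contra! h
    exact absurd (hsmax ⟨⟨hs.1.1.trans hx.1.le, hx.2.le⟩, h⟩) (not_le.2 hx.1)
  · by_contra! h
    exact absurd (htmin ⟨⟨hs.1.1.trans hx.1.le, hx.2.le.trans ht.1.2⟩, h⟩) (not_le.2 hx.2)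

/-- The increment over a crossing interval is at most the integral of the gradient norm.
Cauchy–Schwarz with the factors `t^(-1/2)` and `t^(1/2)` then gives the bound, as the integral of
`1/t` over the crossing is at most `-log r`. -/
theorem ray_estimate {r : ℝ} (hr : 0 < r) (hr1 : r < 1) {U : ℂ → ℝ} {e : ℂ} (he : ‖e‖ = 1)
    {α β : ℝ} (hαβ : α < β) (hU : ContinuousOn (fun t : ℝ => U (t * e)) (Icc r 1))
    (h0 : U (r * e) ≤ α) (h1 : β ≤ U e) {F : ℂ → ℝ≥0∞}
    (hF : ∀ t ∈ Ioo r 1, α < U (t * e) → U (t * e) < β →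
      DifferentiableAt ℝ U (t * e) ∧ ‖fderiv ℝ U (t * e)‖ₑ ^ 2 ≤ F (t * e)) :
    ENNReal.ofReal ((β - α) ^ 2) ≤ ENNReal.ofReal (-Real.log r) *
      ∫⁻ t in Ioo r 1, ENNReal.ofReal t * F (t * e) := by
  obtain ⟨a, b, hra, hab, hb1, hfa, hfb, hcr⟩ := exists_crossing hr1.le hU hαβ h0 (by simpa using h1)
  have hsub : Ioo a b ⊆ Ioo r 1 := Ioo_subset_Ioo hra hb1
  have hH : Measurable fun t : ℝ => ‖fderiv ℝ U (t * e)‖ₑ :=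
    ((measurable_fderiv ℝ U).comp (Continuous.measurable (by fun_prop))).enorm
  have hder : ∀ t ∈ Ioo a b, HasDerivAt (fun s : ℝ => U (s * e)) (fderiv ℝ U (t * e) e) t := by
    intro t ht
    have h := (hF t (hsub ht) (hcr t ht).1 (hcr t ht).2).1.hasFDerivAt
    have h2 : HasDerivAt (fun s : ℝ => (s : ℂ) * e) e t := by
      simpa using (Complex.ofRealCLM.hasDerivAt (x := t)).mul_const e
    exact h.comp_hasDerivAt t h2
  have hle : ∀ t : ℝ, ‖fderiv ℝ U (t * e) e‖ₑ ≤ ‖fderiv ℝ U (t * e)‖ₑ := by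
    intro t
    have := (fderiv ℝ U (t * e)).le_opNorm e
    rw [he, mul_one] at this
    exact enorm_le_iff_norm_le.2 this
  have hmeas : Measurable fun t : ℝ => fderiv ℝ U (t * e) e :=
    (measurable_fderiv_apply_const ℝ U e).comp (Continuous.measurable (by fun_prop))
  have key : ENNReal.ofReal (β - α) ≤ ∫⁻ t in Ioo a b, ‖fderiv ℝ U (t * e)‖ₑ := by
    -- An infinite integral makes the bound trivial; a finite one supplies the integrability that
    -- the fundamental theorem of calculus needs.
    by_cases hfin : ∫⁻ t in Ioo a b, ‖fderiv ℝ U (t * e) e‖ₑ = ⊤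
    · exact le_trans (by simp [hfin]) (lintegral_mono hle)
    · have hint : IntegrableOn (fun t : ℝ => fderiv ℝ U (t * e) e) (Ioo a b) :=
        ⟨hmeas.aestronglyMeasurable, lt_top_iff_ne_top.2 hfin⟩
      have hftc := intervalIntegral.integral_eq_sub_of_hasDerivAt_of_le hab.le
        (hU.mono (Icc_subset_Icc hra hb1)) hder
        ((intervalIntegrable_iff_integrableOn_Ioo_of_le hab.le).2 hint)
      rw [intervalIntegral.integral_of_le hab.le, integral_Ioc_eq_integral_Ioo] at hftc
      have h2 := enorm_integral_le_lintegral_enorm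
        (μ := volume.restrict (Ioo a b)) (fun t : ℝ => fderiv ℝ U (t * e) e)
      rw [hftc, Real.enorm_eq_ofReal_abs] at h2
      refine le_trans (ENNReal.ofReal_le_ofReal ?_) (h2.trans (lintegral_mono hle))
      exact le_trans (by linarith) (le_abs_self _)
  have hcs := ENNReal.lintegral_mul_le_Lp_mul_Lq (volume.restrict (Ioo a b))
    Real.HolderConjugate.two_two
    (f := fun t => ENNReal.ofReal t⁻¹ ^ (1 / 2 : ℝ))
    (g := fun t => ENNReal.ofReal t ^ (1 / 2 : ℝ) * ‖fderiv ℝ U (t * e)‖ₑ)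
    (by fun_prop) (by fun_prop)
  have e1 : ∫⁻ t in Ioo a b, ‖fderiv ℝ U (t * e)‖ₑ = ∫⁻ t in Ioo a b,
      ((fun t : ℝ => ENNReal.ofReal t⁻¹ ^ (1 / 2 : ℝ)) *
        fun t : ℝ => ENNReal.ofReal t ^ (1 / 2 : ℝ) * ‖fderiv ℝ U (t * e)‖ₑ) t := by
    refine setLIntegral_congr_fun measurableSet_Ioo fun t ht => ?_
    have ht0 : 0 < t := hr.trans (hsub ht).1
    simp only [Pi.mul_apply]
    rw [← mul_assoc, ← ENNReal.mul_rpow_of_nonneg _ _ (by norm_num),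
      ← ENNReal.ofReal_mul (inv_nonneg.2 ht0.le), inv_mul_cancel₀ ht0.ne']
    simp
  have e2 : ∀ t : ℝ, (ENNReal.ofReal t⁻¹ ^ (1 / 2 : ℝ)) ^ (2 : ℝ) = ENNReal.ofReal t⁻¹ := by
    intro t
    rw [← ENNReal.rpow_mul]; norm_num
  have e3 : ∀ t : ℝ, (ENNReal.ofReal t ^ (1 / 2 : ℝ) * ‖fderiv ℝ U (t * e)‖ₑ) ^ (2 : ℝ) =
      ENNReal.ofReal t * ‖fderiv ℝ U (t * e)‖ₑ ^ 2 := by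
    intro t
    rw [ENNReal.mul_rpow_of_nonneg _ _ (by norm_num), ← ENNReal.rpow_mul]
    norm_num
  simp only [e2, e3] at hcs
  rw [← e1, ← ENNReal.mul_rpow_of_nonneg _ _ (by norm_num)] at hcs
  have h5 := ENNReal.rpow_le_rpow (key.trans hcs) (z := 2) (by norm_num)
  rw [← ENNReal.rpow_mul] at h5
  norm_num at h5
  rw [← ENNReal.ofReal_pow (sub_nonneg.2 hαβ.le)] at h5
  refine h5.trans (mul_le_mul' ?_ ?_)
  · rw [← lintegral_inv_Ioo hr hr1]
    exact lintegral_mono_set hsub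
  · refine le_trans (setLIntegral_mono' measurableSet_Ioo fun t ht => ?_) (lintegral_mono_set hsub)
    exact mul_le_mul_right (hF t (hsub ht) (hcr t ht).1 (hcr t ht).2).2 _

/-- Apply `ray_estimate` to `u ∘ ψ` on each radius, integrate over the angle, and change variables
by `ψ`. Injectivity of `ψ` ensures that the energy of `u` is counted at most once. -/
theorem length_area {ψ : ℂ → Sphere} {r : ℝ} (hr : 0 < r) (hr1 : r < 1)
    (hψ : ContinuousOn ψ {w | r ≤ ‖w‖ ∧ ‖w‖ ≤ 1}) (hψi : InjOn ψ {w | r < ‖w‖ ∧ ‖w‖ < 1})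
    (hψd : ∀ w, r < ‖w‖ → ‖w‖ < 1 → ψ w ≠ OnePoint.infty →
      DifferentiableAt ℂ (fun w => affine (ψ w)) w)
    {u : Sphere → ℝ} (hu : Continuous u) {α β : ℝ} (hαβ : α < β) {A : Set Sphere}
    (hA : ∀ x, α < u x → u x < β → x ∈ A)
    (hud : ∀ z : ℂ, α < u z → u z < β → DifferentiableAt ℝ (fun z : ℂ => u z) z)
    (h0 : ∀ w, ‖w‖ = r → u (ψ w) ≤ α) (h1 : ∀ w, ‖w‖ = 1 → β ≤ u (ψ w)) :
    ENNReal.ofReal (2 * Real.pi * (β - α) ^ 2 / (-Real.log r)) ≤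
      ∫⁻ z in {z : ℂ | (z : Sphere) ∈ A}, ‖fderiv ℝ (fun z : ℂ => u z) z‖ₑ ^ 2 := by
  have hL : 0 < -Real.log r := neg_pos.2 (Real.log_neg hr hr1)
  set R : Set ℂ := {w | r < ‖w‖ ∧ ‖w‖ < 1} with hRdef
  have hR : IsOpen R :=
    (isOpen_lt continuous_const continuous_norm).inter (isOpen_lt continuous_norm continuous_const)
  have hψR : ContinuousOn ψ R := hψ.mono fun w hw => ⟨hw.1.le, hw.2.le⟩
  -- Infinity is removed so that `ψ` can be read in the affine coordinate on `Ω`.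
  set Y : Set Sphere := {OnePoint.infty}ᶜ ∩ {x | α < u x ∧ u x < β} with hYdef
  have hY : IsOpen Y := (isClosed_singleton.isOpen_compl).inter
    ((isOpen_lt continuous_const hu).inter (isOpen_lt hu continuous_const))
  set Ω : Set ℂ := R ∩ ψ ⁻¹' Y with hΩdef
  have hΩ : IsOpen Ω := hψR.isOpen_inter_preimage hR hY
  set g : ℂ → ℂ := fun w => affine (ψ w) with hgdef
  have hgψ : ∀ w ∈ Ω, (g w : Sphere) = ψ w := fun w hw => coe_affine hw.2.1
  have hgd : ∀ w ∈ Ω, DifferentiableAt ℂ g w := fun w hw => hψd w hw.1.1 hw.1.2 hw.2.1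
  have hgi : InjOn g Ω := fun x hx y hy hxy =>
    hψi hx.1 hy.1 (by rw [← hgψ x hx, ← hgψ y hy, hxy])
  set U : ℂ → ℝ := fun w => u (ψ w) with hUdef
  have hUd : ∀ w ∈ Ω, DifferentiableAt ℝ U w ∧
      ‖fderiv ℝ U w‖ₑ ≤ ‖deriv g w‖ₑ * ‖fderiv ℝ (fun z : ℂ => u z) (g w)‖ₑ := by
    intro w hw
    have hu1 : HasFDerivAt (fun z : ℂ => u z) (fderiv ℝ (fun z : ℂ => u z) (g w)) (g w) :=
      (hud (g w) (by rw [hgψ w hw]; exact hw.2.2.1) (by rw [hgψ w hw]; exact hw.2.2.2)).hasFDerivAt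
    have hc := hu1.comp w ((hgd w hw).hasDerivAt.hasFDerivAt.restrictScalars ℝ)
    have hUe : U =ᶠ[𝓝 w] (fun z : ℂ => u z) ∘ g := by
      filter_upwards [hΩ.mem_nhds hw] with y hy
      simp only [Function.comp_apply, hgψ y hy, hUdef]
    have hU := hc.congr_of_eventuallyEq hUe
    refine ⟨hU.differentiableAt, ?_⟩
    rw [hU.fderiv, mul_comm, ← ofReal_norm, ← ofReal_norm, ← ofReal_norm,
      ← ENNReal.ofReal_mul (norm_nonneg _)]
    refine ENNReal.ofReal_le_ofReal ((ContinuousLinearMap.opNorm_comp_le _ _).trans ?_)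
    simp
  -- At most one parameter is sent to `∞`, so at most one radius meets it, and a single angle is
  -- negligible.
  have hbad : {θ : ℝ | θ ∈ Ioo (-Real.pi) Real.pi ∧ ∃ t ∈ Ioo r 1,
      ψ (t * Complex.exp (θ * Complex.I)) = OnePoint.infty}.Subsingleton := by
    rintro θ ⟨hθ, t, ht, h⟩ θ' ⟨hθ', t', ht', h'⟩
    have hmem : ∀ (s φ : ℝ), s ∈ Ioo r 1 → (s : ℂ) * Complex.exp (φ * Complex.I) ∈ R := by
      intro s φ hs
      have := hr.trans hs.1
      simpa [hRdef, Complex.norm_exp_ofReal_mul_I, abs_of_pos this] using hs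
    have he := hψi (hmem t θ ht) (hmem t' θ' ht') (h.trans h'.symm)
    have h1 := congrArg Complex.arg he
    rwa [Complex.exp_mul_I, Complex.exp_mul_I,
      Complex.arg_mul_cos_add_sin_mul_I (hr.trans ht.1) ⟨hθ.1, hθ.2.le⟩,
      Complex.arg_mul_cos_add_sin_mul_I (hr.trans ht'.1) ⟨hθ'.1, hθ'.2.le⟩] at h1
  have hrays : ∀ᵐ θ : ℝ ∂((volume : Measure ℝ).restrict (Ioo (-Real.pi) Real.pi)),
      ENNReal.ofReal ((β - α) ^ 2 / (-Real.log r)) ≤ ∫⁻ t in Ioo r 1, ENNReal.ofReal t *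
        Ω.indicator (fun w => ‖fderiv ℝ U w‖ₑ ^ 2) (t * Complex.exp (θ * Complex.I)) := by
    have hae : ∀ᵐ θ : ℝ, θ ∉ {θ : ℝ | θ ∈ Ioo (-Real.pi) Real.pi ∧ ∃ t ∈ Ioo r 1,
        ψ (t * Complex.exp (θ * Complex.I)) = OnePoint.infty} :=
      measure_eq_zero_iff_ae_notMem.1 (hbad.measure_zero _)
    filter_upwards [ae_restrict_of_ae hae, ae_restrict_mem measurableSet_Ioo] with θ hθ hθI
    have hne : ∀ t ∈ Ioo r 1, ψ (t * Complex.exp (θ * Complex.I)) ≠ OnePoint.infty :=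
      fun t ht h => hθ ⟨hθI, t, ht, h⟩
    have hnorm : ∀ t : ℝ, 0 ≤ t → ‖(t : ℂ) * Complex.exp (θ * Complex.I)‖ = t := fun t ht => by
      simp [Complex.norm_exp_ofReal_mul_I, abs_of_nonneg ht]
    have hest := ray_estimate hr hr1 (U := U) (Complex.norm_exp_ofReal_mul_I θ) hαβ
      (F := Ω.indicator fun w => ‖fderiv ℝ U w‖ₑ ^ 2) ?_ (h0 _ (hnorm r hr.le))
      (h1 _ (Complex.norm_exp_ofReal_mul_I θ)) ?_
    · rw [ENNReal.ofReal_div_of_pos hL]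
      refine ENNReal.div_le_of_le_mul' hest
    · refine hu.comp_continuousOn (hψ.comp (Continuous.continuousOn (by fun_prop)) ?_)
      intro t ht
      have h := hnorm t (hr.le.trans ht.1)
      exact ⟨h.symm ▸ ht.1, h.symm ▸ ht.2⟩
    · intro t ht ha hb
      have h := hnorm t (hr.trans ht.1).le
      have hmem : (t : ℂ) * Complex.exp (θ * Complex.I) ∈ Ω :=
        ⟨⟨h.symm ▸ ht.1, h.symm ▸ ht.2⟩, hne t ht, ha, hb⟩
      exact ⟨(hUd _ hmem).1, by rw [indicator_of_mem hmem]⟩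
  calc ENNReal.ofReal (2 * Real.pi * (β - α) ^ 2 / (-Real.log r))
      = ∫⁻ _ in Ioo (-Real.pi) Real.pi, ENNReal.ofReal ((β - α) ^ 2 / (-Real.log r)) := by
        rw [setLIntegral_const, Real.volume_Ioo, ← ENNReal.ofReal_mul (by positivity)]
        congr 1
        ring
    _ ≤ ∫⁻ θ in Ioo (-Real.pi) Real.pi, ∫⁻ t in Ioo r 1, ENNReal.ofReal t *
          Ω.indicator (fun w => ‖fderiv ℝ U w‖ₑ ^ 2) (t * Complex.exp (θ * Complex.I)) :=
        lintegral_mono_ae hrays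
    _ = ∫⁻ w in R, Ω.indicator (fun w => ‖fderiv ℝ U w‖ₑ ^ 2) w :=
        (lintegral_annulus hr (((measurable_fderiv ℝ U).enorm.pow_const 2).indicator
          hΩ.measurableSet)).symm
    _ ≤ ∫⁻ w, Ω.indicator (fun w => ‖fderiv ℝ U w‖ₑ ^ 2) w := setLIntegral_le_lintegral _ _
    _ = ∫⁻ w in Ω, ‖fderiv ℝ U w‖ₑ ^ 2 := lintegral_indicator hΩ.measurableSet _
    _ ≤ ∫⁻ w in Ω, ‖deriv g w‖ₑ ^ 2 * ‖fderiv ℝ (fun z : ℂ => u z) (g w)‖ₑ ^ 2 := by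
        refine setLIntegral_mono' hΩ.measurableSet fun w hw => ?_
        rw [← mul_pow]
        exact pow_le_pow_left' (hUd w hw).2 2
    _ = ∫⁻ z in g '' Ω, ‖fderiv ℝ (fun z : ℂ => u z) z‖ₑ ^ 2 :=
        (lintegral_image_holomorphic hΩ.measurableSet hgd hgi
          fun z => ‖fderiv ℝ (fun z : ℂ => u z) z‖ₑ ^ 2).symm
    _ ≤ _ := by
        refine lintegral_mono_set ?_
        rintro _ ⟨w, hw, rfl⟩
        rw [mem_ofPred_eq, hgψ w hw]
        exact hA _ hw.2.2.1 hw.2.2.2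

/-! ### Test functions -/

/-- A `C¹` step from `0` to `1` that takes place inside `(0, 1)`, with slope at most `c`. -/
structure IsStep (φ : ℝ → ℝ) (c : ℝ) : Prop where
  contDiff : ContDiff ℝ 1 φ
  eq_zero : ∀ t ≤ 0, φ t = 0
  eq_one : ∃ t₀, 0 < t₀ ∧ t₀ < 1 ∧ ∀ t, t₀ ≤ t → φ t = 1
  abs_deriv_le : ∀ t, |deriv φ t| ≤ c

/-- Integrate a normalized bump centred at `1/2`. Its plateau has length `1/c`, which bounds the
density by `c`, and `c > 1` leaves room for a support strictly inside `(0, 1)`. -/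
theorem exists_isStep {c : ℝ} (hc : 1 < c) : ∃ φ, IsStep φ c := by
  have hc0 : 0 < c := zero_lt_one.trans hc
  have hin : 1 / (2 * c) < 1 / 2 := by
    rw [div_lt_div_iff₀ (by positivity) two_pos]; linarith
  let f : ContDiffBump (1 / 2 : ℝ) :=
    ⟨1 / (2 * c), (1 / (2 * c) + 1 / 2) / 2, by positivity, by linarith⟩
  have hin' : f.rIn = 1 / (2 * c) := rfl
  have hout : f.rOut < 1 / 2 := show (1 / (2 * c) + 1 / 2) / 2 < 1 / 2 by linarith
  have hout0 : 0 < f.rOut := f.rOut_pos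
  have hcont : Continuous (f.normed volume) := f.continuous_normed
  have hsupp : Function.support (f.normed volume) = Ioo (1 / 2 - f.rOut) (1 / 2 + f.rOut) := by
    rw [f.support_normed_eq, Real.ball_eq_Ioo]
  have hder : ∀ t, HasDerivAt (fun t => ∫ s in (0 : ℝ)..t, f.normed volume s)
      (f.normed volume t) t := fun t =>
    intervalIntegral.integral_hasDerivAt_right (hcont.intervalIntegrable _ _)
      hcont.stronglyMeasurable.stronglyMeasurableAtFilter hcont.continuousAt
  have hderiv : deriv (fun t => ∫ s in (0 : ℝ)..t, f.normed volume s) = f.normed volume :=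
    funext fun t => (hder t).deriv
  refine ⟨fun t => ∫ s in (0 : ℝ)..t, f.normed volume s, ?_, ?_, ?_, ?_⟩
  · rw [contDiff_one_iff_deriv, hderiv]
    exact ⟨fun t => (hder t).differentiableAt, hcont⟩
  · intro t ht
    refine (intervalIntegral.integral_congr (g := fun _ => (0 : ℝ)) fun s hs => ?_).trans
      intervalIntegral.integral_zero
    rw [uIcc_of_ge ht] at hs
    by_contra h
    have := (hsupp.subset h : s ∈ Ioo _ _).1
    linarith [hs.2]
  · refine ⟨1 / 2 + f.rOut, by linarith, by linarith, fun t ht => ?_⟩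
    rw [intervalIntegral.integral_eq_integral_of_support_subset, f.integral_normed]
    rw [hsupp]
    exact fun s hs => ⟨by linarith [hs.1], by linarith [hs.2]⟩
  · intro t
    rw [hderiv, abs_of_nonneg (f.nonneg_normed t)]
    refine (f.normed_le_div_measure_closedBall_rIn volume t).trans (le_of_eq ?_)
    rw [hin', Real.volume_real_closedBall (by positivity)]
    field_simp

/-- The radial test function in a disc. -/
def testFun (D : Set Sphere) (χ : Sphere → ℂ) (r : ℝ) (φ : ℝ → ℝ) (x : Sphere) : ℝ :=
  open Classical in if x ∈ D then φ (Real.log (‖χ x‖ / r) / -Real.log r) else 1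

theorem contDiffAt_radial {φ : ℝ → ℝ} (hφ : ContDiff ℝ 1 φ) {r v : ℝ} (hr : 0 < r) {w : ℂ}
    (hw : w ≠ 0) : ContDiffAt ℝ 1 (fun w : ℂ => φ (Real.log (‖w‖ / r) / v)) w := by
  have h1 : ContDiffAt ℝ 1 (fun w : ℂ => ‖w‖ / r) w := (contDiffAt_norm ℝ hw).div_const r
  have h2 := (h1.log (div_ne_zero (norm_ne_zero_iff.2 hw) hr.ne')).div_const v
  exact hφ.contDiffAt.comp w h2

theorem norm_fderiv_radial_le {φ : ℝ → ℝ} (hφ : ContDiff ℝ 1 φ) {c : ℝ}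
    (hc : ∀ t, |deriv φ t| ≤ c) {r v : ℝ} (hr : 0 < r) (hv : 0 < v) {w : ℂ} (hw : w ≠ 0) :
    ‖fderiv ℝ (fun w : ℂ => φ (Real.log (‖w‖ / r) / v)) w‖ ≤ c / (v * ‖w‖) := by
  have hw' : 0 < ‖w‖ := norm_pos_iff.2 hw
  have hn : HasFDerivAt (fun w : ℂ => ‖w‖) (fderiv ℝ (fun w : ℂ => ‖w‖) w) w :=
    (differentiableAt_id.norm ℝ hw).hasFDerivAt
  have hlip : ‖fderiv ℝ (fun w : ℂ => ‖w‖) w‖ ≤ 1 := by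
    simpa using norm_fderiv_le_of_lipschitz ℝ (x₀ := w) (lipschitzWith_one_norm (E := ℂ))
  have hs : HasDerivAt (fun s : ℝ => φ (Real.log (s / r) / v))
      (deriv φ (Real.log (‖w‖ / r) / v) * ((‖w‖)⁻¹ / v)) ‖w‖ := by
    have h1 : HasDerivAt (fun s : ℝ => Real.log (s / r) / v) ((‖w‖)⁻¹ / v) ‖w‖ := by
      have h2 := (((hasDerivAt_id ‖w‖).div_const r).log (div_ne_zero hw'.ne' hr.ne')).div_const v
      have he : 1 / r / (id ‖w‖ / r) / v = (‖w‖)⁻¹ / v := by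
        simp only [id]
        field_simp
      rwa [he] at h2
    exact ((hφ.differentiable one_ne_zero).differentiableAt.hasDerivAt).comp ‖w‖ h1
  have h := hs.comp_hasFDerivAt w hn
  have h' : HasFDerivAt (fun w : ℂ => φ (Real.log (‖w‖ / r) / v)) _ w := h
  rw [h'.fderiv, norm_smul, norm_mul, Real.norm_eq_abs, Real.norm_of_nonneg (by positivity)]
  calc |deriv φ (Real.log (‖w‖ / r) / v)| * ((‖w‖)⁻¹ / v) * ‖fderiv ℝ (fun w : ℂ => ‖w‖) w‖
      ≤ c * ((‖w‖)⁻¹ / v) * 1 := by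
        have := (abs_nonneg _).trans (hc 0)
        gcongr
        exact hc _
    _ = c / (v * ‖w‖) := by field_simp

theorem lintegral_radial {r : ℝ} (hr : 0 < r) (hr1 : r < 1) {c : ℝ} :
    ∫⁻ w in {w : ℂ | r < ‖w‖ ∧ ‖w‖ < 1}, ENNReal.ofReal ((c / (-Real.log r * ‖w‖)) ^ 2) =
      ENNReal.ofReal (c ^ 2 * (2 * Real.pi / -Real.log r)) := by
  have hL : 0 < -Real.log r := neg_pos.2 (Real.log_neg hr hr1)
  rw [lintegral_annulus hr (by fun_prop)]
  have hin : ∀ θ : ℝ, ∫⁻ t in Ioo r 1, ENNReal.ofReal t *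
      ENNReal.ofReal ((c / (-Real.log r * ‖(t : ℂ) * Complex.exp (θ * Complex.I)‖)) ^ 2) =
      ENNReal.ofReal (c ^ 2 / -Real.log r) := by
    intro θ
    calc _ = ∫⁻ t in Ioo r 1, ENNReal.ofReal (c ^ 2 / Real.log r ^ 2) * ENNReal.ofReal t⁻¹ := by
          refine setLIntegral_congr_fun measurableSet_Ioo fun t ht => ?_
          have ht0 : 0 < t := hr.trans ht.1
          have hnorm : ‖(t : ℂ) * Complex.exp (θ * Complex.I)‖ = t := by
            simp [Complex.norm_exp_ofReal_mul_I, abs_of_pos ht0]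
          simp only [hnorm]
          rw [← ENNReal.ofReal_mul ht0.le, ← ENNReal.ofReal_mul (by positivity)]
          congr 1
          have := hL.ne'
          field_simp
      _ = _ := by
          rw [lintegral_const_mul _ (by fun_prop), lintegral_inv_Ioo hr hr1,
            ← ENNReal.ofReal_mul (by positivity)]
          congr 1
          have : Real.log r ≠ 0 := fun h => by simp [h] at hL
          field_simp
  simp only [hin]
  rw [setLIntegral_const, Real.volume_Ioo, ← ENNReal.ofReal_mul (by positivity)]
  congr 1
  ring

section TestFun

variable {D : Set Sphere} {a : Sphere} {χ : Sphere → ℂ} {φ : ℝ → ℝ} {c r : ℝ}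

theorem testFun_of_mem {x : Sphere} (hx : x ∈ D) :
    testFun D χ r φ x = φ (Real.log (‖χ x‖ / r) / -Real.log r) := if_pos hx

theorem testFun_of_notMem {x : Sphere} (hx : x ∉ D) : testFun D χ r φ x = 1 := if_neg hx

theorem testFun_of_mem_core (hφ : IsStep φ c) (hr : 0 < r) (hr1 : r < 1) {x : Sphere}
    (hx : x ∈ core D χ r) : testFun D χ r φ x = 0 := by
  rw [testFun_of_mem hx.1]
  refine hφ.eq_zero _ (div_nonpos_of_nonpos_of_nonneg (Real.log_nonpos (by positivity) ?_)
    (neg_pos.2 (Real.log_neg hr hr1)).le)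
  exact (div_le_one hr).2 hx.2

/-- This takes care of the zero of `χ`, where `log |χ|` is singular. -/
theorem testFun_eventuallyEq_zero (h : IsConformalRepresentation D a χ) (hD : IsOpen D)
    (hφ : IsStep φ c) (hr : 0 < r) (hr1 : r < 1) {x : Sphere} (hx : x ∈ D) (hx0 : χ x = 0) :
    testFun D χ r φ =ᶠ[𝓝 x] fun _ => 0 := by
  have ho : IsOpen {x ∈ D | ‖χ x‖ ∈ Iio r} := h.isOpen_norm_mem hD isOpen_Iio
  filter_upwards [ho.mem_nhds ⟨hx, by simpa [hx0] using hr⟩] with y hy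
  exact testFun_of_mem_core hφ hr hr1 ⟨hy.1, (mem_Iio.1 hy.2).le⟩

/-- The step has value `1` from `t₀ < 1` on, that is, once `|χ| ≥ r^(1 - t₀)`. The closed core of
that radius avoids a neighbourhood of `x`. Smoothness across the boundary of `D` follows, whatever
its shape. -/
theorem testFun_eventuallyEq_one (h : IsConformalRepresentation D a χ) (hD : IsOpen D)
    (hφ : IsStep φ c) (hr : 0 < r) (hr1 : r < 1) {x : Sphere} (hx : x ∉ D) :
    testFun D χ r φ =ᶠ[𝓝 x] fun _ => 1 := by
  have hl : Real.log r < 0 := Real.log_neg hr hr1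
  obtain ⟨t₀, ht₀, ht₁, hone⟩ := hφ.eq_one
  have hρ1 : Real.exp ((1 - t₀) * Real.log r) < 1 :=
    Real.exp_lt_one_iff.2 (mul_neg_of_pos_of_neg (by linarith) hl)
  have ho := (h.isClosed_core hD hρ1).isOpen_compl
  filter_upwards [ho.mem_nhds fun hx' => hx hx'.1] with y hy
  by_cases hyD : y ∈ D
  · rw [testFun_of_mem hyD]
    refine hone _ ?_
    have h1 : Real.exp ((1 - t₀) * Real.log r) < ‖χ y‖ := not_le.1 fun h' => hy ⟨hyD, h'⟩
    have h2 := Real.log_lt_log (Real.exp_pos _) h1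
    rw [Real.log_exp] at h2
    rw [Real.log_div (((Real.exp_pos _).trans h1).ne') hr.ne', le_div_iff₀ (neg_pos.2 hl)]
    linarith
  · exact testFun_of_notMem hyD

theorem continuous_testFun (h : IsConformalRepresentation D a χ) (hD : IsOpen D)
    (hφ : IsStep φ c) (hr : 0 < r) (hr1 : r < 1) : Continuous (testFun D χ r φ) := by
  rw [continuous_iff_continuousAt]
  intro x
  by_cases hx : x ∈ D
  · by_cases hx0 : χ x = 0
    · exact continuousAt_const.congr (testFun_eventuallyEq_zero h hD hφ hr hr1 hx hx0).symm
    · have h1 : ContinuousAt χ x := (h.holomorphicOn.continuousOn hD).continuousAt (hD.mem_nhds hx)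
      have h2 := ContinuousAt.comp (f := χ) (x := x)
        (contDiffAt_radial (v := -Real.log r) hφ.contDiff hr hx0).continuousAt h1
      refine h2.congr ?_
      filter_upwards [hD.mem_nhds hx] with y hy
      exact (testFun_of_mem hy).symm
  · exact continuousAt_const.congr (testFun_eventuallyEq_one h hD hφ hr hr1 hx).symm

theorem testFun_eventuallyEq_comp (hD : IsOpen D) {z : ℂ} (hz : (z : Sphere) ∈ D) :
    (fun z : ℂ => testFun D χ r φ z) =ᶠ[𝓝 z]
      (fun w : ℂ => φ (Real.log (‖w‖ / r) / -Real.log r)) ∘ fun z : ℂ => χ z := by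
  filter_upwards [(hD.preimage OnePoint.continuous_coe).mem_nhds hz] with y hy
  exact testFun_of_mem hy

theorem contDiff_testFun (h : IsConformalRepresentation D a χ) (hD : IsOpen D)
    (hφ : IsStep φ c) (hr : 0 < r) (hr1 : r < 1) :
    ContDiff ℝ 1 (fun z : ℂ => testFun D χ r φ z) := by
  rw [contDiff_iff_contDiffAt]
  intro z
  have hcoe : Tendsto (fun z : ℂ => (z : Sphere)) (𝓝 z) (𝓝 (z : Sphere)) :=
    OnePoint.continuous_coe.continuousAt
  by_cases hz : (z : Sphere) ∈ D
  · by_cases hz0 : χ z = 0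
    · exact contDiffAt_const.congr_of_eventuallyEq
        (hcoe.eventually (testFun_eventuallyEq_zero h hD hφ hr hr1 hz hz0))
    · refine ContDiffAt.congr_of_eventuallyEq ?_ (testFun_eventuallyEq_comp hD hz)
      have hχ : ContDiffAt ℝ 1 (fun z : ℂ => χ z) z :=
        ((h.holomorphicOn.1.analyticAt ((hD.preimage OnePoint.continuous_coe).mem_nhds
          hz)).contDiffAt (n := 1)).restrict_scalars ℝ
      exact ContDiffAt.comp z (contDiffAt_radial hφ.contDiff hr hz0) hχ
  · exact contDiffAt_const.congr_of_eventuallyEq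
      (hcoe.eventually (testFun_eventuallyEq_one h hD hφ hr hr1 hz))

theorem fderiv_testFun_of_notMem (h : IsConformalRepresentation D a χ) (hD : IsOpen D)
    (hφ : IsStep φ c) (hr : 0 < r) (hr1 : r < 1) {z : ℂ} (hz : (z : Sphere) ∉ D) :
    fderiv ℝ (fun z : ℂ => testFun D χ r φ z) z = 0 := by
  have he : (fun z : ℂ => testFun D χ r φ z) =ᶠ[𝓝 z] fun _ => 1 :=
    OnePoint.continuous_coe.continuousAt.eventually
      (testFun_eventuallyEq_one h hD hφ hr hr1 hz)
  rw [he.fderiv_eq]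
  simp

/-- By the chain rule the gradient is at most `|χ'| c / (v |χ|)` with `v = -log r`. The substitution
`w = χ z` reduces the bound to an explicit integral over the round annulus. -/
theorem energy_testFun_le (h : IsConformalRepresentation D a χ) (hD : IsOpen D)
    (hφ : IsStep φ c) (hr : 0 < r) (hr1 : r < 1) :
    ∫⁻ z in {z : ℂ | (z : Sphere) ∈ collar D χ r},
      ‖fderiv ℝ (fun z : ℂ => testFun D χ r φ z) z‖ₑ ^ 2 ≤
        ENNReal.ofReal (c ^ 2 * (2 * Real.pi / -Real.log r)) := by
  have hL : 0 < -Real.log r := neg_pos.2 (Real.log_neg hr hr1)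
  have hs : MeasurableSet {z : ℂ | (z : Sphere) ∈ collar D χ r} :=
    ((h.isOpen_collar hD).preimage OnePoint.continuous_coe).measurableSet
  have hd : ∀ z ∈ {z : ℂ | (z : Sphere) ∈ collar D χ r},
      DifferentiableAt ℂ (fun z : ℂ => χ z) z := fun z hz =>
    h.holomorphicOn.1.differentiableAt ((hD.preimage OnePoint.continuous_coe).mem_nhds hz.1)
  have hi : InjOn (fun z : ℂ => χ z) {z : ℂ | (z : Sphere) ∈ collar D χ r} :=
    fun x hx y hy hxy => OnePoint.coe_injective (h.bijOn.injOn hx.1 hy.1 hxy)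
  calc _ ≤ ∫⁻ z in {z : ℂ | (z : Sphere) ∈ collar D χ r}, ‖deriv (fun z : ℂ => χ z) z‖ₑ ^ 2 *
        ENNReal.ofReal ((c / (-Real.log r * ‖χ z‖)) ^ 2) := by
        refine setLIntegral_mono' hs fun z hz => ?_
        have hz0 : χ z ≠ 0 := norm_pos_iff.1 (hr.trans hz.2)
        have hc1 := ((contDiffAt_radial (v := -Real.log r) hφ.contDiff hr hz0).differentiableAt
          one_ne_zero).hasFDerivAt
        have hc2 := (hc1.comp z ((hd z hz).hasDerivAt.hasFDerivAt.restrictScalars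
          ℝ)).congr_of_eventuallyEq (testFun_eventuallyEq_comp (r := r) (φ := φ) hD hz.1)
        have hc0 : 0 ≤ c := (abs_nonneg _).trans (hφ.abs_deriv_le 0)
        rw [ENNReal.ofReal_pow (by positivity), ← mul_pow]
        refine pow_le_pow_left' ?_ 2
        rw [hc2.fderiv, ← ofReal_norm, ← ofReal_norm, ← ENNReal.ofReal_mul (norm_nonneg _), mul_comm]
        refine ENNReal.ofReal_le_ofReal ((ContinuousLinearMap.opNorm_comp_le _ _).trans ?_)
        refine mul_le_mul (norm_fderiv_radial_le hφ.contDiff hφ.abs_deriv_le hr hL hz0) ?_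
          (norm_nonneg _) (by positivity)
        simp
    _ = ∫⁻ w in (fun z : ℂ => χ z) '' {z : ℂ | (z : Sphere) ∈ collar D χ r},
        ENNReal.ofReal ((c / (-Real.log r * ‖w‖)) ^ 2) :=
      (lintegral_image_holomorphic hs hd hi
        fun w => ENNReal.ofReal ((c / (-Real.log r * ‖w‖)) ^ 2)).symm
    _ ≤ ∫⁻ w in {w : ℂ | r < ‖w‖ ∧ ‖w‖ < 1}, ENNReal.ofReal ((c / (-Real.log r * ‖w‖)) ^ 2) := by
      refine lintegral_mono_set ?_
      rintro _ ⟨z, hz, rfl⟩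
      exact ⟨hz.2, h.norm_lt_one hz.1⟩
    _ = _ := lintegral_radial hr hr1

end TestFun

/-! ### Capacities -/

theorem le_capacity {A E F : Set Sphere} (hA : IsAnnulus A E F) {m : ℝ≥0∞}
    (H : ∀ u : Sphere → ℝ, Continuous u →
      ContDiffOn ℝ 1 (fun z : ℂ => u z) {z : ℂ | (z : Sphere) ∈ A} →
      (∀ x ∈ E, u x = 0) → (∀ x ∈ F, u x = 1) →
      m ≤ ∫⁻ z in {z : ℂ | (z : Sphere) ∈ A}, ‖fderiv ℝ (fun w : ℂ => u w) z‖ₑ ^ 2) :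
    m ≤ capacity A := by
  refine le_iInf fun u => le_iInf fun hu => ?_
  obtain ⟨hc, hd, E', F', hA', hE, hF⟩ := hu
  rcases hA.unique hA' with ⟨rfl, rfl⟩ | ⟨rfl, rfl⟩
  · exact H u hc hd hE hF
  -- With the components labelled the other way round, `1 - u` has the required boundary values and
  -- the same energy.
  · have := H (fun x => 1 - u x) (continuous_const.sub hc) (contDiffOn_const.sub hd)
      (fun x hx => by rw [hF x hx, sub_self]) (fun x hx => by rw [hE x hx, sub_zero])
    simpa only [fderiv_const_sub, enorm_neg] using this

/-- The radii need only reach a level `β < 1`, and `β` tends to `1` at the end. Hence `ψ`, which may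
depend on `u` and `β`, need not extend to the boundary of the annulus. -/
theorem le_capacity_of_length_area {A E F : Set Sphere} (hA : IsAnnulus A E F) {L : ℝ}
    (H : ∀ u : Sphere → ℝ, Continuous u → (∀ x ∈ E, u x = 0) → (∀ x ∈ F, u x = 1) →
      ∀ β : ℝ, 0 < β → β < 1 → ∃ (ψ : ℂ → Sphere) (r : ℝ), 0 < r ∧ r < 1 ∧ -Real.log r ≤ L ∧
        ContinuousOn ψ {w | r ≤ ‖w‖ ∧ ‖w‖ ≤ 1} ∧ InjOn ψ {w | r < ‖w‖ ∧ ‖w‖ < 1} ∧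
        (∀ w, r < ‖w‖ → ‖w‖ < 1 → ψ w ≠ OnePoint.infty →
          DifferentiableAt ℂ (fun w => affine (ψ w)) w) ∧
        (∀ w, ‖w‖ = r → ψ w ∈ E) ∧ ∀ w, ‖w‖ = 1 → β ≤ u (ψ w)) :
    ENNReal.ofReal (2 * Real.pi / L) ≤ capacity A := by
  have hAo : IsOpen A := by
    rw [← isClosed_compl_iff, hA.compl_eq]
    exact hA.isClosed_left.union hA.isClosed_right
  refine le_capacity hA fun u hu hud hE hF => ?_
  have key : ∀ β : ℝ, 0 < β → β < 1 → ENNReal.ofReal (2 * Real.pi * β ^ 2 / L) ≤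
      ∫⁻ z in {z : ℂ | (z : Sphere) ∈ A}, ‖fderiv ℝ (fun w : ℂ => u w) z‖ₑ ^ 2 := by
    intro β hβ hβ1
    obtain ⟨ψ, r, hr, hr1, hrL, hψ, hψi, hψd, h0, h1⟩ := H u hu hE hF β hβ hβ1
    have hmem : ∀ x, 0 < u x → u x < β → x ∈ A := by
      intro x hx0 hx1
      by_contra hxA
      rcases (hA.compl_eq.subset hxA : x ∈ E ∪ F) with h | h
      · exact hx0.ne' (hE x h)
      · linarith [hF x h]
    have hl : 0 < -Real.log r := neg_pos.2 (Real.log_neg hr hr1)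
    have := length_area hr hr1 hψ hψi hψd hu hβ hmem
      (fun z hz0 hz1 => (hud.differentiableOn one_ne_zero).differentiableAt
        ((hAo.preimage OnePoint.continuous_coe).mem_nhds (hmem z hz0 hz1)))
      (fun w hw => (hE _ (h0 w hw)).le) h1
    refine le_trans (ENNReal.ofReal_le_ofReal ?_) this
    rw [sub_zero]
    gcongr
  have ht : Tendsto (fun β : ℝ => ENNReal.ofReal (2 * Real.pi * β ^ 2 / L)) (𝓝[<] 1)
      (𝓝 (ENNReal.ofReal (2 * Real.pi / L))) := by
    have hc : Continuous fun β : ℝ => ENNReal.ofReal (2 * Real.pi * β ^ 2 / L) :=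
      ENNReal.continuous_ofReal.comp (by fun_prop)
    simpa using (hc.tendsto 1).mono_left nhdsWithin_le_nhds
  refine le_of_tendsto ht ?_
  filter_upwards [Ioo_mem_nhdsLT (zero_lt_one (α := ℝ))] with β hβ
  exact key β hβ.1 hβ.2

theorem capacity_le_of_forall {A : Set Sphere} {y : ℝ}
    (H : ∀ c : ℝ, 1 < c → capacity A ≤ ENNReal.ofReal (c ^ 2 * y)) :
    capacity A ≤ ENNReal.ofReal y := by
  have ht : Tendsto (fun c : ℝ => ENNReal.ofReal (c ^ 2 * y)) (𝓝[>] 1)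
      (𝓝 (ENNReal.ofReal y)) := by
    have hc : Continuous fun c : ℝ => ENNReal.ofReal (c ^ 2 * y) :=
      ENNReal.continuous_ofReal.comp (by fun_prop)
    simpa using (hc.tendsto 1).mono_left nhdsWithin_le_nhds
  refine ge_of_tendsto ht ?_
  filter_upwards [self_mem_nhdsWithin] with c hc
  exact H c hc

theorem le_modulus {A : Set Sphere} {v : ℝ} (hv : 0 < v)
    (h : capacity A ≤ ENNReal.ofReal (2 * Real.pi / v)) : ENNReal.ofReal v ≤ modulus A := by
  have h2 := ENNReal.div_le_div_left h (ENNReal.ofReal (2 * Real.pi))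
  refine le_trans (le_of_eq ?_) h2
  rw [← ENNReal.ofReal_div_of_pos (by positivity)]
  congr 1
  field_simp

theorem modulus_le {A : Set Sphere} {v : ℝ} (hv : 0 < v)
    (h : ENNReal.ofReal (2 * Real.pi / v) ≤ capacity A) : modulus A ≤ ENNReal.ofReal v := by
  have h2 := ENNReal.div_le_div_left h (ENNReal.ofReal (2 * Real.pi))
  refine h2.trans (le_of_eq ?_)
  rw [← ENNReal.ofReal_div_of_pos (by positivity)]
  congr 1
  field_simp

/-! ### Potentials, and capacity bounds for one and two discs -/

namespace IsConformalRepresentation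

theorem capacity_collar_le {D : Set Sphere} {a : Sphere} {χ : Sphere → ℂ}
    (h : IsConformalRepresentation D a χ) (hD : IsOpen D) (hne : Dᶜ.Nonempty) {r : ℝ} (hr : 0 < r)
    (hr1 : r < 1) : capacity (collar D χ r) ≤ ENNReal.ofReal (2 * Real.pi / -Real.log r) := by
  refine capacity_le_of_forall fun c hc => ?_
  obtain ⟨φ, hφ⟩ := exists_isStep hc
  refine (iInf₂_le (testFun D χ r φ) ⟨continuous_testFun h hD hφ hr hr1,
    (contDiff_testFun h hD hφ hr hr1).contDiffOn, _, _, h.isAnnulus_collar hD hne hr.le hr1,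
    fun x hx => testFun_of_mem_core hφ hr hr1 hx, fun x hx => testFun_of_notMem hx⟩).trans ?_
  exact energy_testFun_le h hD hφ hr hr1

theorem le_capacity_collar {D : Set Sphere} {a : Sphere} {χ : Sphere → ℂ}
    (h : IsConformalRepresentation D a χ) (hD : IsOpen D) (hne : Dᶜ.Nonempty) {r : ℝ} (hr : 0 < r)
    (hr1 : r < 1) : ENNReal.ofReal (2 * Real.pi / -Real.log r) ≤ capacity (collar D χ r) := by
  refine le_capacity_of_length_area (h.isAnnulus_collar hD hne hr.le hr1)
    fun u hu _ hF β hβ hβ1 => ?_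
  -- The set `u ≤ β` is compact in `D` because `u = 1` off `D`, so `u > β` wherever `|χ| > b₀`.
  obtain ⟨b₀, hb₀, hb₀1, hb⟩ := h.exists_norm_le hD (isClosed_le hu (continuous_const (y := β)))
    fun x hx => by
      by_contra hxD
      have := hF x hxD
      have hx' : u x ≤ β := hx
      linarith
  obtain ⟨b, hmb, hb1⟩ := exists_between (max_lt hr1 hb₀1)
  have hrb : r < b := (le_max_left _ _).trans_lt hmb
  have hb₀b : b₀ < b := (le_max_right _ _).trans_lt hmb
  have hb0 : 0 < b := hr.trans hrb
  have hnorm : ∀ w : ℂ, ‖(b : ℂ) * w‖ = b * ‖w‖ := fun w => by simp [abs_of_pos hb0]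
  have hlt : ∀ w : ℂ, ‖w‖ ≤ 1 → ‖(b : ℂ) * w‖ < 1 := fun w hw => by
    rw [hnorm]; exact (mul_le_of_le_one_right hb0.le hw).trans_lt hb1
  -- Rescaling by `b` turns the circle `|χ| = b` into the unit circle and `|χ| = r` into radius `r /
  -- b`, which only shortens the logarithmic length.
  refine ⟨fun w => conformalInv D χ (b * w), r / b, by positivity, (div_lt_one hb0).2 hrb,
    ?_, ?_, ?_, ?_, ?_, ?_⟩
  · exact neg_le_neg (Real.log_le_log hr (by rw [le_div_iff₀ hb0]; nlinarith))
  · exact (h.continuousOn_inv hD).comp (by fun_prop) fun w hw => hlt w hw.2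
  · intro x hx y hy hxy
    have := h.injOn_inv (hlt x hx.2.le) (hlt y hy.2.le) hxy
    exact mul_left_cancel₀ (Complex.ofReal_ne_zero.2 hb0.ne') this
  · intro w _ hw hne
    exact (h.differentiableAt_affine_inv hD (hlt w hw.le) hne).comp w
      (f := fun w : ℂ => (b : ℂ) * w) (by fun_prop)
  · intro w hw
    have h1 : ‖(b : ℂ) * w‖ < 1 := by rw [hnorm, hw, mul_div_cancel₀ _ hb0.ne']; exact hr1
    refine ⟨h.inv_mem h1, ?_⟩
    rw [h.apply_inv h1, hnorm, hw, mul_div_cancel₀ _ hb0.ne']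
    exact mem_Iic.2 le_rfl
  · intro w hw
    by_contra! hcon
    have := hb _ hcon.le
    rw [h.apply_inv (hlt w hw.le), hnorm, hw] at this
    linarith

theorem potential_eq {D : Set Sphere} {a : Sphere} {χ : Sphere → ℂ}
    (h : IsConformalRepresentation D a χ) (hD : IsOpen D) (hne : Dᶜ.Nonempty) {r : ℝ} (hr : 0 < r)
    (hr1 : r < 1) : potential D {x ∈ D | ‖χ x‖ = r} = ENNReal.ofReal (-Real.log r) := by
  have hL : 0 < -Real.log r := neg_pos.2 (Real.log_neg hr hr1)
  rw [potential, h.annulusBetween_frontier hD hne hr.le hr1]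
  exact le_antisymm (modulus_le hL (h.le_capacity_collar hD hne hr hr1))
    (le_modulus hL (h.capacity_collar_le hD hne hr hr1))

theorem capacity_between_le {D₁ D₂ : Set Sphere} {a₁ a₂ : Sphere} {χ₁ χ₂ : Sphere → ℂ}
    (h₁ : IsConformalRepresentation D₁ a₁ χ₁)
    (h₂ : IsConformalRepresentation D₂ a₂ χ₂) (hD₁ : IsOpen D₁) (hD₂ : IsOpen D₂)
    (hD : Disjoint D₁ D₂) {r₁ r₂ : ℝ} (hr₁ : 0 < r₁) (hr₁' : r₁ < 1) (hr₂ : 0 < r₂)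
    (hr₂' : r₂ < 1) : capacity (core D₁ χ₁ r₁ ∪ core D₂ χ₂ r₂)ᶜ ≤
      ENNReal.ofReal (2 * Real.pi / (-Real.log r₁ + -Real.log r₂)) := by
  refine capacity_le_of_forall fun c hc => ?_
  obtain ⟨φ, hφ⟩ := exists_isStep hc
  have hv₁ : 0 < -Real.log r₁ := neg_pos.2 (Real.log_neg hr₁ hr₁')
  have hv₂ : 0 < -Real.log r₂ := neg_pos.2 (Real.log_neg hr₂ hr₂')
  have hen₁ := energy_testFun_le h₁ hD₁ hφ hr₁ hr₁'
  have hen₂ := energy_testFun_le h₂ hD₂ hφ hr₂ hr₂'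
  set v₁ := -Real.log r₁ with hv₁def
  set v₂ := -Real.log r₂ with hv₂def
  -- These weights minimize `s₁² / v₁ + s₂² / v₂` subject to `s₁ + s₂ = 1`; the minimum is `1 / (v₁
  -- + v₂)`.
  set s₁ : ℝ := v₁ / (v₁ + v₂) with hs₁
  set s₂ : ℝ := v₂ / (v₁ + v₂) with hs₂
  have hs : s₁ + s₂ = 1 := by rw [hs₁, hs₂]; field_simp
  set G₁ := testFun D₁ χ₁ r₁ φ with hG₁
  set G₂ := testFun D₂ χ₂ r₂ φ with hG₂
  have hd₁ : ContDiff ℝ 1 fun z : ℂ => G₁ z := contDiff_testFun h₁ hD₁ hφ hr₁ hr₁'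
  have hd₂ : ContDiff ℝ 1 fun z : ℂ => G₂ z := contDiff_testFun h₂ hD₂ hφ hr₂ hr₂'
  have hc₁ : Continuous G₁ := continuous_testFun h₁ hD₁ hφ hr₁ hr₁'
  have hc₂ : Continuous G₂ := continuous_testFun h₂ hD₂ hφ hr₂ hr₂'
  -- The function rises from `0` to `s₁` across the first collar, is constant outside both discs,
  -- and rises from `s₁` to `1` across the second collar.
  have hadm : IsAdmissible (core D₁ χ₁ r₁ ∪ core D₂ χ₂ r₂)ᶜ
      fun x => s₁ * G₁ x + s₂ * (1 - G₂ x) := by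
    refine ⟨by fun_prop, ?_, _, _,
      h₁.isAnnulus_compl_cores h₂ hD₁ hD₂ hD hr₁.le hr₁' hr₂.le hr₂', ?_, ?_⟩
    · exact ((contDiff_const.mul hd₁).add
        (contDiff_const.mul (contDiff_const.sub hd₂))).contDiffOn
    · intro x hx
      simp only [hG₁, hG₂]
      rw [testFun_of_mem_core hφ hr₁ hr₁' hx,
        testFun_of_notMem (Set.disjoint_left.1 hD (core_subset hx))]
      ring
    · intro x hx
      simp only [hG₁, hG₂]
      rw [testFun_of_mem_core hφ hr₂ hr₂' hx,
        testFun_of_notMem (Set.disjoint_right.1 hD (core_subset hx))]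
      linarith
  have hfd : ∀ z : ℂ, fderiv ℝ (fun w : ℂ => s₁ * G₁ w + s₂ * (1 - G₂ w)) z =
      s₁ • fderiv ℝ (fun w : ℂ => G₁ w) z - s₂ • fderiv ℝ (fun w : ℂ => G₂ w) z := by
    intro z
    have e₁ := ((hd₁.differentiable one_ne_zero) z).hasFDerivAt
    have e₂ := ((hd₂.differentiable one_ne_zero) z).hasFDerivAt
    have := (e₁.const_mul s₁).add ((e₂.const_sub 1).const_mul s₂)
    rw [sub_eq_add_neg, ← smul_neg]
    exact HasFDerivAt.fderiv this
  have hsq : ∀ (s : ℝ) (T : ℂ →L[ℝ] ℝ), 0 ≤ s →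
      ‖s • T‖ₑ ^ 2 = ENNReal.ofReal (s ^ 2) * ‖T‖ₑ ^ 2 := by
    intro s T hs
    rw [enorm_smul, mul_pow, Real.enorm_eq_ofReal hs, ENNReal.ofReal_pow hs]
  have hs₁0 : 0 ≤ s₁ := by positivity
  have hs₂0 : 0 ≤ s₂ := by positivity
  set W₁ : Set ℂ := {z : ℂ | (z : Sphere) ∈ collar D₁ χ₁ r₁} with hW₁
  set W₂ : Set ℂ := {z : ℂ | (z : Sphere) ∈ collar D₂ χ₂ r₂} with hW₂
  have hW₁m : MeasurableSet W₁ :=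
    ((h₁.isOpen_collar hD₁).preimage OnePoint.continuous_coe).measurableSet
  have hW₂m : MeasurableSet W₂ :=
    ((h₂.isOpen_collar hD₂).preimage OnePoint.continuous_coe).measurableSet
  set f₁ : ℂ → ℝ≥0∞ := fun z => ENNReal.ofReal (s₁ ^ 2) * ‖fderiv ℝ (fun w : ℂ => G₁ w) z‖ₑ ^ 2
    with hf₁
  set f₂ : ℂ → ℝ≥0∞ := fun z => ENNReal.ofReal (s₂ ^ 2) * ‖fderiv ℝ (fun w : ℂ => G₂ w) z‖ₑ ^ 2
    with hf₂
  have hm₁ : Measurable fun z : ℂ => ‖fderiv ℝ (fun w : ℂ => G₁ w) z‖ₑ ^ 2 :=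
    (measurable_fderiv ℝ _).enorm.pow_const 2
  have hm₂ : Measurable fun z : ℂ => ‖fderiv ℝ (fun w : ℂ => G₂ w) z‖ₑ ^ 2 :=
    (measurable_fderiv ℝ _).enorm.pow_const 2
  have hAm : MeasurableSet {z : ℂ | (z : Sphere) ∈ (core D₁ χ₁ r₁ ∪ core D₂ χ₂ r₂)ᶜ} :=
    ((((h₁.isClosed_core hD₁ hr₁').union (h₂.isClosed_core hD₂ hr₂')).isOpen_compl).preimage
      OnePoint.continuous_coe).measurableSet
  refine (iInf₂_le _ hadm).trans ?_
  calc ∫⁻ z in {z : ℂ | (z : Sphere) ∈ (core D₁ χ₁ r₁ ∪ core D₂ χ₂ r₂)ᶜ},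
        ‖fderiv ℝ (fun w : ℂ => s₁ * G₁ w + s₂ * (1 - G₂ w)) z‖ₑ ^ 2
      ≤ ∫⁻ z in {z : ℂ | (z : Sphere) ∈ (core D₁ χ₁ r₁ ∪ core D₂ χ₂ r₂)ᶜ},
        (W₁.indicator f₁ z + W₂.indicator f₂ z) := by
        -- At each point at most one of the two gradients is nonzero, so there is no cross term.
        refine setLIntegral_mono' hAm fun z hz => ?_
        rw [hfd z]
        by_cases hz₁ : (z : Sphere) ∈ D₁
        · have hzW : z ∈ W₁ := ⟨hz₁, mem_Ioi.2 (not_le.1 fun h => hz (Or.inl ⟨hz₁, h⟩))⟩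
          have h0 : fderiv ℝ (fun w : ℂ => G₂ w) z = 0 :=
            fderiv_testFun_of_notMem h₂ hD₂ hφ hr₂ hr₂' (Set.disjoint_left.1 hD hz₁)
          rw [h0, smul_zero, sub_zero, hsq _ _ hs₁0, indicator_of_mem hzW]
          exact le_self_add
        · have h0 : fderiv ℝ (fun w : ℂ => G₁ w) z = 0 :=
            fderiv_testFun_of_notMem h₁ hD₁ hφ hr₁ hr₁' hz₁
          rw [h0, smul_zero, zero_sub, enorm_neg, hsq _ _ hs₂0]
          by_cases hz₂ : (z : Sphere) ∈ D₂
          · have hzW : z ∈ W₂ := ⟨hz₂, mem_Ioi.2 (not_le.1 fun h => hz (Or.inr ⟨hz₂, h⟩))⟩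
            rw [indicator_of_mem hzW]
            exact le_add_self
          · have h0' : fderiv ℝ (fun w : ℂ => G₂ w) z = 0 :=
              fderiv_testFun_of_notMem h₂ hD₂ hφ hr₂ hr₂' hz₂
            rw [h0', ← ofReal_norm]
            simp
    _ ≤ ∫⁻ z, (W₁.indicator f₁ z + W₂.indicator f₂ z) := setLIntegral_le_lintegral _ _
    _ = (∫⁻ z in W₁, f₁ z) + ∫⁻ z in W₂, f₂ z := by
        rw [lintegral_add_left ((hm₁.const_mul _).indicator hW₁m), lintegral_indicator hW₁m,
          lintegral_indicator hW₂m]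
    _ ≤ ENNReal.ofReal (s₁ ^ 2) * ENNReal.ofReal (c ^ 2 * (2 * Real.pi / v₁)) +
        ENNReal.ofReal (s₂ ^ 2) * ENNReal.ofReal (c ^ 2 * (2 * Real.pi / v₂)) := by
        rw [hf₁, hf₂, lintegral_const_mul _ hm₁, lintegral_const_mul _ hm₂]
        gcongr
    _ = ENNReal.ofReal (c ^ 2 * (2 * Real.pi / (v₁ + v₂))) := by
        rw [← ENNReal.ofReal_mul (by positivity), ← ENNReal.ofReal_mul (by positivity),
          ← ENNReal.ofReal_add (by positivity) (by positivity)]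
        congr 1
        rw [hs₁, hs₂]
        field_simp

/-- Schwarz's lemma in a Möbius coordinate. -/
theorem moebius_mem_core {D : Set Sphere} {χ : Sphere → ℂ} {p₁ q₁ p₂ q₂ : ℂ}
    (h : IsConformalRepresentation D (pt p₁ q₁) χ) (hD : IsOpen D)
    (hdet : p₁ * q₂ - p₂ * q₁ ≠ 0) {ρ : ℝ} (hρ : 0 < ρ)
    (hρD : ∀ w, ‖w‖ < ρ → moebius p₁ q₁ p₂ q₂ w ∈ D) {r : ℝ} (hr1 : r < 1) {w : ℂ}
    (hw : ‖w‖ ≤ ρ * r) : moebius p₁ q₁ p₂ q₂ w ∈ core D χ r := by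
  have hwρ : ‖w‖ < ρ := hw.trans_lt (mul_lt_of_lt_one_right hρ hr1)
  have h0 : χ (moebius p₁ q₁ p₂ q₂ 0) = 0 := by
    rw [moebius, zero_mul, zero_mul, add_zero, add_zero, h.map_mark]
  have hs := Complex.dist_le_div_mul_dist_of_mapsTo_ball (f := fun w => χ (moebius p₁ q₁ p₂ q₂ w))
    (c := 0) (R₁ := ρ) (R₂ := 1) (z := w)
    (fun x hx => (h.holomorphicOn.comp_moebius hD hdet
      (hρD x (mem_ball_zero_iff.1 hx))).differentiableWithinAt)
    (fun x hx => by
      rw [h0]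
      exact Metric.ball_subset_closedBall (h.bijOn.mapsTo (hρD x (mem_ball_zero_iff.1 hx))))
    (mem_ball_zero_iff.2 hwρ)
  refine ⟨hρD w hwρ, ?_⟩
  rw [h0, dist_zero_right, dist_zero_right] at hs
  refine hs.trans ?_
  rw [div_mul_eq_mul_div, one_mul, div_le_iff₀ hρ]
  linarith

theorem le_capacity_between {D₁ D₂ : Set Sphere} {χ₁ χ₂ : Sphere → ℂ} {p₁ q₁ p₂ q₂ : ℂ}
    (h₁ : IsConformalRepresentation D₁ (pt p₁ q₁) χ₁)
    (h₂ : IsConformalRepresentation D₂ (pt p₂ q₂) χ₂) (hD₁ : IsOpen D₁) (hD₂ : IsOpen D₂)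
    (hD : Disjoint D₁ D₂) (hdet : p₁ * q₂ - p₂ * q₁ ≠ 0) {ρ₁ ρ₂ : ℝ} (hρ₁ : 0 < ρ₁)
    (hρ₁1 : ρ₁ < 1) (hρ₂ : 0 < ρ₂) (hρ₂1 : ρ₂ < 1)
    (hρD₁ : ∀ w, ‖w‖ < ρ₁ → moebius p₁ q₁ p₂ q₂ w ∈ D₁)
    (hρD₂ : ∀ w, ‖w‖ < ρ₂ → moebius p₂ q₂ p₁ q₁ w ∈ D₂)
    {r₁ r₂ : ℝ} (hr₁ : 0 < r₁) (hr₁' : r₁ < 1) (hr₂ : 0 < r₂) (hr₂' : r₂ < 1) :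
    ENNReal.ofReal (2 * Real.pi / -Real.log (ρ₁ * r₁ * (ρ₂ * r₂))) ≤
      capacity (core D₁ χ₁ r₁ ∪ core D₂ χ₂ r₂)ᶜ := by
  have hb : 0 < ρ₂ * r₂ := by positivity
  have hlt₁ : ρ₁ * r₁ < 1 := mul_lt_one_of_nonneg_of_lt_one_left hρ₁.le hρ₁1 hr₁'.le
  have hlt₂ : ρ₂ * r₂ < 1 := mul_lt_one_of_nonneg_of_lt_one_left hρ₂.le hρ₂1 hr₂'.le
  have hlt : ρ₁ * r₁ * (ρ₂ * r₂) < 1 :=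
    mul_lt_one_of_nonneg_of_lt_one_left (by positivity) hlt₁ hlt₂.le
  have hpos : 0 < ρ₁ * r₁ * (ρ₂ * r₂) := by positivity
  have hdet' : p₂ * q₁ - p₁ * q₂ ≠ 0 := fun h => hdet (by linear_combination -h)
  have hb' : ((ρ₂ * r₂ : ℝ) : ℂ)⁻¹ ≠ 0 := inv_ne_zero (Complex.ofReal_ne_zero.2 hb.ne')
  have hnorm : ∀ w : ℂ, ‖((ρ₂ * r₂ : ℝ) : ℂ)⁻¹ * w‖ = (ρ₂ * r₂)⁻¹ * ‖w‖ := fun w => by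
    rw [norm_mul, norm_inv, Complex.norm_real, Real.norm_of_nonneg hb.le]
  refine le_capacity_of_length_area
    (h₁.isAnnulus_compl_cores h₂ hD₁ hD₂ hD hr₁.le hr₁' hr₂.le hr₂')
    fun u _ _ hF β _ hβ1 =>
      -- The scaling makes `|w| = 1` correspond to radius `1 / (ρ₂ r₂)` in the Möbius coordinate,
      -- and `|w| = ρ₁ r₁ ρ₂ r₂` to radius `ρ₁ r₁`.
      ⟨fun w => moebius p₁ q₁ p₂ q₂ (((ρ₂ * r₂ : ℝ) : ℂ)⁻¹ * w), _, hpos, hlt, le_rfl,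
        ((continuous_moebius hdet).comp (by fun_prop)).continuousOn, ?_, ?_, ?_, ?_⟩
  · exact fun x _ y _ hxy => mul_left_cancel₀ hb' (moebius_injective hdet hxy)
  · intro w _ _ hne
    exact (differentiableAt_affine_moebius hne).comp w
      (f := fun w : ℂ => ((ρ₂ * r₂ : ℝ) : ℂ)⁻¹ * w) (by fun_prop)
  · intro w hw
    refine h₁.moebius_mem_core hD₁ hdet hρ₁ hρD₁ hr₁' (le_of_eq ?_)
    rw [hnorm, hw]
    field_simp
  · intro w hw
    have hw0 : w ≠ 0 := norm_ne_zero_iff.1 (by rw [hw]; exact one_ne_zero)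
    -- On the outer circle Schwarz's lemma is applied in the inverted coordinate, which has modulus
    -- `ρ₂ r₂` there.
    have hmem := h₂.moebius_mem_core hD₂ hdet' hρ₂ hρD₂ hr₂'
      (w := (((ρ₂ * r₂ : ℝ) : ℂ)⁻¹ * w)⁻¹) (by rw [norm_inv, hnorm, hw, mul_one, inv_inv])
    rw [moebius_inv (mul_ne_zero hb' hw0)] at hmem
    rw [hF _ hmem]
    exact hβ1.le

end IsConformalRepresentation

theorem exists_radius {D : Set Sphere} (hD : IsOpen D) {p₁ q₁ p₂ q₂ : ℂ}
    (hdet : p₁ * q₂ - p₂ * q₁ ≠ 0) (hp : pt p₁ q₁ ∈ D) :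
    ∃ ρ : ℝ, 0 < ρ ∧ ρ < 1 ∧ ∀ w, ‖w‖ < ρ → moebius p₁ q₁ p₂ q₂ w ∈ D := by
  have h0 : (0 : ℂ) ∈ moebius p₁ q₁ p₂ q₂ ⁻¹' D := by
    rw [mem_preimage, moebius, zero_mul, zero_mul, add_zero, add_zero]
    exact hp
  obtain ⟨ε, hε, hball⟩ := Metric.isOpen_iff.1 (hD.preimage (continuous_moebius hdet)) 0 h0
  -- The cap `1/2` keeps `ρ < 1`, so that `-log ρ` contributes positively to the constant.
  refine ⟨min ε (1 / 2), by positivity, (min_le_right _ _).trans_lt (by norm_num), fun w hw => ?_⟩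
  exact hball (mem_ball_zero_iff.2 (hw.trans_le (min_le_left _ _)))

end MarkedDisc

end

/-! ### The reversed Grötzsch inequality -/

theorem mainTheorem10 (D₁ D₂ : Set MarkedDisc.Sphere) (z₁ z₂ : MarkedDisc.Sphere)
    (hD₁ : MarkedDisc.IsHyperbolicDisc D₁) (hD₂ : MarkedDisc.IsHyperbolicDisc D₂)
    (hz₁ : z₁ ∈ D₁) (hz₂ : z₂ ∈ D₂) (hD : Disjoint D₁ D₂) :
    ∃ C : ℝ, 0 < C ∧ ∀ v₁ v₂ : ℝ, 0 < v₁ → 0 < v₂ →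
      ∀ γ₁ γ₂ : Set MarkedDisc.Sphere,
        MarkedDisc.IsEquipotential D₁ z₁ γ₁ →
        MarkedDisc.potential D₁ γ₁ = ENNReal.ofReal v₁ →
        MarkedDisc.IsEquipotential D₂ z₂ γ₂ →
        MarkedDisc.potential D₂ γ₂ = ENNReal.ofReal v₂ →
        ENNReal.ofReal (v₁ + v₂) ≤
            MarkedDisc.modulus (MarkedDisc.annulusBetween γ₁ γ₂) ∧
          MarkedDisc.modulus (MarkedDisc.annulusBetween γ₁ γ₂) ≤
            ENNReal.ofReal (v₁ + v₂ + C) := by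
  have hne : z₁ ≠ z₂ := fun h => Set.disjoint_left.1 hD hz₁ (h ▸ hz₂)
  obtain ⟨p₁, q₁, p₂, q₂, rfl, rfl, hdet⟩ := MarkedDisc.exists_pt hne
  have hdet' : p₂ * q₁ - p₁ * q₂ ≠ 0 := fun h => hdet (by linear_combination -h)
  obtain ⟨ρ₁, hρ₁, hρ₁1, hρD₁⟩ := MarkedDisc.exists_radius hD₁.isOpen hdet hz₁
  obtain ⟨ρ₂, hρ₂, hρ₂1, hρD₂⟩ := MarkedDisc.exists_radius hD₂.isOpen hdet' hz₂
  have hl₁ := Real.log_neg hρ₁ hρ₁1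
  have hl₂ := Real.log_neg hρ₂ hρ₂1
  -- The constant is the excess logarithmic length of the round annulus. The radii are chosen from
  -- the discs and their marks alone, before any equipotential or conformal representation is given.
  refine ⟨-Real.log ρ₁ + -Real.log ρ₂, by linarith, ?_⟩
  rintro v₁ v₂ hv₁ hv₂ _ _ ⟨χ₁, h₁, r₁, hr₁, hr₁', rfl⟩ hpot₁ ⟨χ₂, h₂, r₂, hr₂, hr₂', rfl⟩ hpot₂
  have hlr₁ := Real.log_neg hr₁ hr₁'
  have hlr₂ := Real.log_neg hr₂ hr₂'
  rw [h₁.potential_eq hD₁.isOpen hD₁.nontrivial_compl.nonempty hr₁ hr₁',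
    ENNReal.ofReal_eq_ofReal_iff (by linarith) hv₁.le] at hpot₁
  rw [h₂.potential_eq hD₂.isOpen hD₂.nontrivial_compl.nonempty hr₂ hr₂',
    ENNReal.ofReal_eq_ofReal_iff (by linarith) hv₂.le] at hpot₂
  subst hpot₁ hpot₂
  rw [h₁.annulusBetween_equipotentials h₂ hD₁.isOpen hD₂.isOpen hD hr₁.le hr₁' hr₂.le hr₂']
  refine ⟨MarkedDisc.le_modulus (by linarith)
    (h₁.capacity_between_le h₂ hD₁.isOpen hD₂.isOpen hD hr₁ hr₁' hr₂ hr₂'),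
    MarkedDisc.modulus_le (by linarith) ?_⟩
  have h := h₁.le_capacity_between h₂ hD₁.isOpen hD₂.isOpen hD hdet hρ₁ hρ₁1 hρ₂ hρ₂1 hρD₁ hρD₂
    hr₁ hr₁' hr₂ hr₂'
  rw [Real.log_mul (by positivity) (by positivity), Real.log_mul hρ₁.ne' hr₁.ne',
    Real.log_mul hρ₂.ne' hr₂.ne'] at h
  convert h using 3
  ring
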